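/- For $a\in\mathbb{C}$ and an integer $n\ge 0$ put $(a)_n=a(a+1)\cdots(a+n-1)$, and for $k\ge 1$ put $(a)_{-k}=\dfrac{1}{(a-1)(a-2)\cdots(a-k)}$ (so that $(a)_k=\Gamma(a+k)/\Gamma(a)$ generically). Horn's hypergeometric function $H_5$ is the double series $$H_5\left(a,b;c\mid X,Y\right)=\sum_{m=0}^{\infty}\sum_{n=0}^{\infty}\frac{(a)_{2m+n}(b)_{n-m}}{(c)_n\,m!\,n!}X^mY^n,$$ and ${}_2F_1(a,b;c\mid z)=\sum_{n\ge 0}\frac{(a)_n(b)_n}{(c)_n\,n!}z^n$ is Gauss' hypergeometric function. Let $q\in\mathbb{C}$ be such that $2q\notin\{0,-1,-2,\dots\}$ and $q-\tfrac12\notin\{1,2,3,\dots\}$ (so that all the series below are defined). Then for all $(x,y)\in\mathbb{C}^2$ in some neighbourhood of $(0,0)$ (which may depend on $q$), the $H_5$ double series below converges absolutely and $$H_5\left(q,\,q-\tfrac12;\,2q\;\Big|\;\frac{x(y-1)^2}{4(3xy-1)^2},\;\frac{4(xy^2+1)(x+1)y}{(3xy-1)(y-1)^2}\right)$$ $$=(1-3xy)^q\,(1-y)^{2q-1}\;{}_2F_1\left(\tfrac32q-\tfrac12,\,\tfrac32q;\,q+\tfrac12\;\Big|\;-xy^2\right)\;{}_2F_1\left(\tfrac12q,\,\tfrac12q+\tfrac12;\,\tfrac32-q\;\Big|\;-x\right),$$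 where the powers are principal branches. -/

import Mathlib

open Filter Topology

/-- The shifted factorial `(a)_k = Γ(a + k) / Γ(a)` with an integer index `k`, written without
Gamma functions: `(a)_n = a (a + 1) ⋯ (a + n - 1)` for `n ≥ 0`, and
`(a)_{-k} = 1 / ((a - 1) (a - 2) ⋯ (a - k))` for `k ≥ 1` (in the second case `a` should not be
one of `1, 2, …, k`). -/
noncomputable def shiftedFactorial (a : ℂ) : ℤ → ℂ
  | Int.ofNat n => ∏ j ∈ Finset.range n, (a + (j : ℂ))
  | Int.negSucc n => (∏ j ∈ Finset.range (n + 1), (a - ((j : ℂ) + 1)))⁻¹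

/-- The term of index `(m, n)` of Horn's series `H₅(a, b; c; X, Y)`. -/
noncomputable def hornH5Term (a b c X Y : ℂ) (p : ℕ × ℕ) : ℂ :=
  shiftedFactorial a (2 * (p.1 : ℤ) + (p.2 : ℤ)) * shiftedFactorial b ((p.2 : ℤ) - (p.1 : ℤ)) /
    (shiftedFactorial c (p.2 : ℤ) * (p.1.factorial : ℂ) * (p.2.factorial : ℂ)) *
    X ^ p.1 * Y ^ p.2

/-- Horn's hypergeometric function `H₅(a, b; c; X, Y)`, the sum of its double series. -/
noncomputable def hornH5 (a b c X Y : ℂ) : ℂ :=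
  ∑' p : ℕ × ℕ, hornH5Term a b c X Y p

/-! The substitution (x, y) ↦ (X, Y) fixes the origin and has derivative diag(1/4, -4) there, so it
has an analytic local inverse ψ. Hence the right-hand side, read in the coordinates (X, Y), is an
analytic function H with a convergent double series ∑ d(m, n) X^m Y^n, and it suffices to identify d
with the coefficients of H₅.

Horn's system consists of two equations, but only the one of order two in ϑ_Y is needed, where ϑ_X =
X ∂/∂X and ϑ_Y = Y ∂/∂Y: ϑ_Y(ϑ_Y + 2q - 1)H = Y(q + 2ϑ_X + ϑ_Y)(q - 1/2 + ϑ_Y - ϑ_X)H. On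
coefficients it expresses (n + 1)(2q + n) d(m, n + 1) through d(m, n) (`horn_recursion`). The factor
on the left never vanishes, so d is determined by its values at n = 0. These are read off on the
axis Y = 0, which is y = 0 with x = 4X. There the prefactor and the first Gauss function are 1, and
the second Gauss function at -4X has the coefficients of H₅(X, 0) (`hornH5Coefficient_zero_snd`,
`coefficients_eq_hornH5`).

The equation itself is a finite computation (`EulerBasis.second_order`). Let P be the prefactor, F
and G the two Gauss functions, F₁ and G₁ their images under ϑ. By Gauss' equation the span of PFG,
PF₁G, PFG₁, PF₁G₁ over ℂ(x, y) is stable under x ∂/∂x and y ∂/∂y, hence under ϑ_X and ϑ_Y. Comparing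
the four coordinates of the two sides leaves four polynomial identities in x, y and q. -/

/-! ### Double power series at the origin: operations and uniqueness -/

theorem summable_geometric_double (C : ℝ) {s : ℝ} (h0 : 0 ≤ s) (h1 : s < 1) :
    Summable fun k : ℕ × ℕ => C * s ^ (k.1 + k.2) := by
  have h := summable_geometric_of_lt_one h0 h1
  simpa only [pow_add] using (h.mul_of_nonneg h (fun _ => pow_nonneg h0 _)
    (fun _ => pow_nonneg h0 _)).mul_left C

/-- `F` is represented near the origin by the double power series with coefficients `c`. -/
def IsDoubleSeries (F : ℂ × ℂ → ℂ) (c : ℕ × ℕ → ℂ) : Prop :=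
  (∃ C R : ℝ, 0 ≤ C ∧ 1 ≤ R ∧ ∀ k, ‖c k‖ ≤ C * R ^ (k.1 + k.2)) ∧
    ∀ᶠ p : ℂ × ℂ in 𝓝 0, HasSum (fun k => c k * p.1 ^ k.1 * p.2 ^ k.2) (F p)

theorem norm_monomial_le {c : ℕ × ℕ → ℂ} {C R ρ : ℝ} (hC : ∀ k, ‖c k‖ ≤ C * R ^ (k.1 + k.2))
    {p : ℂ × ℂ} (hp : ‖p‖ ≤ ρ) (k : ℕ × ℕ) :
    ‖c k * p.1 ^ k.1 * p.2 ^ k.2‖ ≤ C * (R * ρ) ^ (k.1 + k.2) := by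
  have h1 : ‖p.1‖ ≤ ρ := (norm_fst_le p).trans hp
  have h2 : ‖p.2‖ ≤ ρ := (norm_snd_le p).trans hp
  have hρ : 0 ≤ ρ := (norm_nonneg _).trans hp
  rw [norm_mul, norm_mul, norm_pow, norm_pow, mul_pow, pow_add ρ, mul_assoc, ← mul_assoc C]
  have := (norm_nonneg _).trans (hC k)
  gcongr
  exact hC k

theorem eventually_norm_le {r : ℝ} (hr : 0 < r) : ∀ᶠ p : ℂ × ℂ in 𝓝 0, ‖p‖ ≤ r := by
  filter_upwards [Metric.closedBall_mem_nhds (0 : ℂ × ℂ) hr] with p hp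
  simpa using hp

theorem eventually_summable_monomials {c : ℕ × ℕ → ℂ} {C R : ℝ} (hR : 1 ≤ R)
    (hC : ∀ k, ‖c k‖ ≤ C * R ^ (k.1 + k.2)) :
    ∀ᶠ p : ℂ × ℂ in 𝓝 0, Summable (fun k => c k * p.1 ^ k.1 * p.2 ^ k.2) := by
  filter_upwards [eventually_norm_le (show 0 < 1 / (2 * R) by positivity)] with p hp
  have hs : R * (1 / (2 * R)) = 1 / 2 := by field_simp
  have := norm_monomial_le hC hp
  rw [hs] at this
  exact .of_norm_bounded (summable_geometric_double C (by norm_num) (by norm_num)) this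

namespace IsDoubleSeries

variable {F G : ℂ × ℂ → ℂ} {c d : ℕ × ℕ → ℂ}

theorem congr_left (h : IsDoubleSeries F c) (hFG : F =ᶠ[𝓝 0] G) : IsDoubleSeries G c := by
  refine ⟨h.1, ?_⟩
  filter_upwards [h.2, hFG] with p hp hq
  rwa [← hq]

theorem add (hF : IsDoubleSeries F c) (hG : IsDoubleSeries G d) :
    IsDoubleSeries (fun p => F p + G p) (fun k => c k + d k) := by
  obtain ⟨⟨C, R, hC, hR, hc⟩, hF⟩ := hF
  obtain ⟨⟨D, S, hD, hS, hd⟩, hG⟩ := hG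
  refine ⟨⟨C + D, max R S, by positivity, le_max_of_le_left hR, fun k => ?_⟩, ?_⟩
  · rw [add_mul]
    refine (norm_add_le _ _).trans (add_le_add ((hc k).trans ?_) ((hd k).trans ?_))
    · gcongr; exact le_max_left _ _
    · gcongr; exact le_max_right _ _
  · filter_upwards [hF, hG] with p h1 h2
    simpa only [add_mul] using h1.add h2

theorem const_mul (a : ℂ) (hF : IsDoubleSeries F c) :
    IsDoubleSeries (fun p => a * F p) (fun k => a * c k) := by
  obtain ⟨⟨C, R, hC, hR, hc⟩, hF⟩ := hF
  refine ⟨⟨‖a‖ * C, R, by positivity, hR, fun k => ?_⟩, ?_⟩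
  · rw [norm_mul, mul_assoc]
    gcongr
    exact hc k
  · filter_upwards [hF] with p h1
    simpa only [mul_assoc] using h1.mul_left a

theorem sub (hF : IsDoubleSeries F c) (hG : IsDoubleSeries G d) :
    IsDoubleSeries (fun p => F p - G p) (fun k => c k - d k) := by
  simpa only [neg_one_mul, ← sub_eq_add_neg] using hF.add (hG.const_mul (-1))

theorem mul_snd (hF : IsDoubleSeries F c) :
    IsDoubleSeries (fun p => p.2 * F p) (fun k => if k.2 = 0 then 0 else c (k.1, k.2 - 1)) := by
  obtain ⟨⟨C, R, hC, hR, hc⟩, hF⟩ := hF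
  refine ⟨⟨C, R, hC, hR, fun k => ?_⟩, ?_⟩
  · dsimp only
    split_ifs
    · simp only [norm_zero]; positivity
    · refine (hc _).trans ?_
      gcongr
      exact Nat.sub_le _ _
  · filter_upwards [hF] with p h1
    -- Multiplication by y shifts the second index; the indices outside the range of the shift carry
    -- the coefficient 0.
    have hinj : Function.Injective (fun k : ℕ × ℕ => (k.1, k.2 + 1)) := by
      rintro ⟨a, b⟩ ⟨a', b'⟩ h
      simpa using h
    rw [← hinj.hasSum_iff]
    · convert! h1.mul_left p.2 using 2 with k
      simp only [Function.comp, Nat.add_eq_zero_iff, one_ne_zero, and_false, if_false,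
        Nat.add_sub_cancel]
      ring
    · rintro ⟨a, b⟩ hk
      have : b = 0 := by
        by_contra hb
        exact hk ⟨(a, b - 1), by simp; omega⟩
      simp [this]

end IsDoubleSeries

theorem coeff_eq_zero_of_hasSum_zero {a : ℕ → ℂ}
    (h : ∀ᶠ z : ℂ in 𝓝 0, HasSum (fun n => a n * z ^ n) 0) : a = 0 := by
  have : HasFPowerSeriesAt (0 : ℂ → ℂ) (FormalMultilinearSeries.ofScalars ℂ a) 0 := by
    rw [hasFPowerSeriesAt_iff]
    filter_upwards [h] with z hz
    simpa [FormalMultilinearSeries.coeff_ofScalars, mul_comm] using hz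
  have h0 := this.eq_zero
  ext n
  rw [← FormalMultilinearSeries.coeff_ofScalars (p := a) (n := n), h0]
  rfl

/-- The one-variable identity theorem is applied twice. For fixed small X, summing over m first
gives a power series in Y that vanishes near 0; each of its coefficients is in turn a power series
in X that vanishes near 0. -/
theorem IsDoubleSeries.eq_zero {c : ℕ × ℕ → ℂ} (h : IsDoubleSeries (fun _ => 0) c) : c = 0 := by
  obtain ⟨⟨C, R, hC, hR, hc⟩, hF⟩ := h
  have key : ∀ᶠ X : ℂ in 𝓝 0, ∀ n, HasSum (fun m => c (m, n) * X ^ m) 0 := by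
    have h3 := Filter.Eventually.curry_nhds (x := (0 : ℂ)) (y := (0 : ℂ)) hF
    filter_upwards [h3, Metric.closedBall_mem_nhds (0 : ℂ) (show 0 < 1 / (2 * R) by positivity)]
      with X hX hXR
    have hXR' : ‖X‖ ≤ 1 / (2 * R) := by simpa using hXR
    have hs : ∀ n, Summable (fun m => c (m, n) * X ^ m) := by
      intro n
      refine .of_norm_bounded ((summable_geometric_of_lt_one (r := 1 / 2) (by norm_num)
        (by norm_num)).mul_left (C * R ^ n)) fun m => ?_
      rw [norm_mul, norm_pow]
      calc ‖c (m, n)‖ * ‖X‖ ^ m ≤ C * R ^ (m + n) * (1 / (2 * R)) ^ m := by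
            gcongr
            exact hc _
        _ = _ := by rw [pow_add, one_div, mul_inv, mul_pow, one_div, inv_pow R]; field_simp
    intro n
    have hz : (fun n => ∑' m, c (m, n) * X ^ m) = 0 := by
      refine coeff_eq_zero_of_hasSum_zero ?_
      filter_upwards [hX] with Y hY
      rw [← (Equiv.prodComm ℕ ℕ).hasSum_iff] at hY
      exact hY.prod_fiberwise fun n => (hs n).hasSum.mul_right (Y ^ n)
    have := (hs n).hasSum
    rwa [congrFun hz n] at this
  ext ⟨m, n⟩
  exact congrFun (coeff_eq_zero_of_hasSum_zero (key.mono fun X hX => hX n)) m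

theorem IsDoubleSeries.unique {F : ℂ × ℂ → ℂ} {c d : ℕ × ℕ → ℂ} (hc : IsDoubleSeries F c)
    (hd : IsDoubleSeries F d) : c = d := by
  have := (hc.sub hd).congr_left (G := fun _ => 0) (Eventually.of_forall fun p => sub_self _)
  exact sub_eq_zero.1 this.eq_zero

/-! ### Double series of analytic functions of two variables -/

section Analytic

variable {F : ℂ × ℂ → ℂ}

/-- Multilinear expansion at p = (x, 0) + (0, y): each set s of slots filled with (x, 0) contributes
x^|s| y^(N - |s|), and the sets are grouped by cardinality. -/
theorem sum_piecewise_coordinates {N : ℕ}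
    (f : ContinuousMultilinearMap ℂ (fun _ : Fin N => ℂ × ℂ) ℂ) (p : ℂ × ℂ) :
    f (fun _ => p) = ∑ k ∈ Finset.HasAntidiagonal.antidiagonal N,
      (∑ s ∈ Finset.powersetCard k.1 Finset.univ,
        f (s.piecewise (fun _ => (1, 0)) (fun _ => (0, 1)))) * p.1 ^ k.1 * p.2 ^ k.2 := by
  have hp : (fun _ : Fin N => p) = (fun _ => (p.1, 0)) + (fun _ => (0, p.2)) := by
    ext <;> simp
  rw [hp, ContinuousMultilinearMap.map_add_univ, Finset.Nat.sum_antidiagonal_eq_sum_range_succ_mk,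
    ← Finset.powerset_univ, Finset.sum_powerset, Finset.card_univ, Fintype.card_fin]
  refine Finset.sum_congr rfl fun m _ => ?_
  rw [mul_assoc, Finset.sum_mul]
  refine Finset.sum_congr rfl fun s hs => ?_
  have hs : s.card = m := (Finset.mem_powersetCard.1 hs).2
  have h1 : s.piecewise (fun _ : Fin N => ((p.1, 0) : ℂ × ℂ)) (fun _ => (0, p.2)) =
      fun i => (s.piecewise (fun _ => p.1) (fun _ => p.2) i : ℂ) •
        s.piecewise (fun _ => ((1, 0) : ℂ × ℂ)) (fun _ => (0, 1)) i := by
    funext i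
    by_cases hi : i ∈ s <;> simp [hi]
  rw [h1, ContinuousMultilinearMap.map_smul_univ, Finset.prod_piecewise, smul_eq_mul, mul_comm]
  simp [hs, Finset.card_sdiff]

theorem AnalyticAt.exists_isDoubleSeries (hF : AnalyticAt ℂ F 0) :
    ∃ c, IsDoubleSeries F c := by
  obtain ⟨P, hP⟩ := hF
  obtain ⟨C, r, hC, hr, hPn⟩ := P.le_mul_pow_of_radius_pos hP.radius_pos
  set d : ∀ N : ℕ, ℕ → ℂ := fun N m => ∑ s ∈ Finset.powersetCard m (Finset.univ : Finset (Fin N)),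
        P N (s.piecewise (fun _ => (1, 0)) (fun _ => (0, 1))) with hd
  -- The coefficient is a sum of at most 2^N values of an N-linear form of norm at most C r^N on
  -- vectors of norm 1, where N = k.1 + k.2; this explains the rate 2r.
  have hb : ∀ k : ℕ × ℕ, ‖d (k.1 + k.2) k.1‖ ≤ C * (max 1 (2 * r)) ^ (k.1 + k.2) := by
    intro k
    have h1 : ∀ s ∈ Finset.powersetCard k.1 (Finset.univ : Finset (Fin (k.1 + k.2))),
        ‖P (k.1 + k.2) (s.piecewise (fun _ => ((1, 0) : ℂ × ℂ)) (fun _ => (0, 1)))‖ ≤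
          C * r ^ (k.1 + k.2) := by
      intro s _
      refine (ContinuousMultilinearMap.le_opNorm _ _).trans ?_
      rw [Finset.prod_eq_one, mul_one]
      · exact hPn _
      · intro i _
        by_cases hi : i ∈ s <;> simp [hi, Prod.norm_def]
    refine (norm_sum_le_of_le _ h1).trans ?_
    rw [Finset.sum_const, Finset.card_powersetCard, Finset.card_univ, Fintype.card_fin,
      nsmul_eq_mul]
    calc ((k.1 + k.2).choose k.1 : ℝ) * (C * r ^ (k.1 + k.2))
        ≤ (2 : ℝ) ^ (k.1 + k.2) * (C * r ^ (k.1 + k.2)) := by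
          gcongr
          exact_mod_cast Nat.choose_le_two_pow _ _
      _ = C * (2 * r) ^ (k.1 + k.2) := by rw [mul_pow]; ring
      _ ≤ _ := by gcongr; exact le_max_right _ _
  refine ⟨fun k => d (k.1 + k.2) k.1, ⟨C, max 1 (2 * r), hC.le, le_max_left _ _, hb⟩, ?_⟩
  filter_upwards [eventually_summable_monomials (le_max_left _ _) hb, hP.eventually_hasSum] with p hs hp
  rw [zero_add] at hp
  -- Summability allows regrouping by total degree N; the part of degree N is the N-th homogeneous
  -- term of the Taylor series.
  have h2 := (Finset.HasAntidiagonal.sigmaAntidiagonalEquivProd.hasSum_iff.2 hs.hasSum)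
  have h3 := h2.sigma (g := fun N => P N fun _ => p) (fun N => by
    convert! hasSum_fintype _
    rw [sum_piecewise_coordinates, ← Finset.sum_coe_sort]
    refine Finset.sum_congr rfl fun k _ => ?_
    have hk := Finset.HasAntidiagonal.mem_antidiagonal.1 k.2
    simp only [Function.comp, Finset.HasAntidiagonal.sigmaAntidiagonalEquivProd_apply, hd, hk])
  have h4 := hs.hasSum
  rwa [h3.unique hp] at h4

end Analytic

/-! ### Euler derivatives: termwise differentiation and calculus rules -/

/-- `F` is differentiable at `p`, with Euler derivatives `x ∂F/∂x = A` and `y ∂F/∂y = B` there. -/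
def EulerAt (F : ℂ × ℂ → ℂ) (p : ℂ × ℂ) (A B : ℂ) : Prop :=
  ∃ L : ℂ × ℂ →L[ℂ] ℂ, HasFDerivAt F L p ∧ L (p.1, 0) = A ∧ L (0, p.2) = B

/-- The Euler derivative `x ∂F/∂x`. -/
noncomputable def eulerFst (F : ℂ × ℂ → ℂ) (p : ℂ × ℂ) : ℂ := fderiv ℂ F p (p.1, 0)

/-- The Euler derivative `y ∂F/∂y`. -/
noncomputable def eulerSnd (F : ℂ × ℂ → ℂ) (p : ℂ × ℂ) : ℂ := fderiv ℂ F p (0, p.2)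

theorem EulerAt.eq {F : ℂ × ℂ → ℂ} {p : ℂ × ℂ} {A B : ℂ} (h : EulerAt F p A B) :
    eulerFst F p = A ∧ eulerSnd F p = B := by
  obtain ⟨L, hL, hA, hB⟩ := h
  rw [eulerFst, eulerSnd, hL.fderiv]
  exact ⟨hA, hB⟩

theorem DifferentiableAt.eulerAt {F : ℂ × ℂ → ℂ} {p : ℂ × ℂ} (h : DifferentiableAt ℂ F p) :
    EulerAt F p (eulerFst F p) (eulerSnd F p) :=
  ⟨_, h.hasFDerivAt, rfl, rfl⟩

theorem AnalyticAt.eulerFst {F : ℂ × ℂ → ℂ} {p : ℂ × ℂ} (h : AnalyticAt ℂ F p) :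
    AnalyticAt ℂ (eulerFst F) p := by
  unfold _root_.eulerFst
  have h1 := ((ContinuousLinearMap.apply ℂ ℂ ((1, 0) : ℂ × ℂ)).analyticAt _).comp h.fderiv
  refine (analyticAt_fst.mul h1).congr (Eventually.of_forall fun p => ?_)
  have : ((p.1, 0) : ℂ × ℂ) = p.1 • ((1, 0) : ℂ × ℂ) := by simp
  dsimp only
  rw [this, map_smul]
  rfl

theorem AnalyticAt.eulerSnd {F : ℂ × ℂ → ℂ} {p : ℂ × ℂ} (h : AnalyticAt ℂ F p) :
    AnalyticAt ℂ (eulerSnd F) p := by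
  unfold _root_.eulerSnd
  have h1 := ((ContinuousLinearMap.apply ℂ ℂ ((0, 1) : ℂ × ℂ)).analyticAt _).comp h.fderiv
  refine (analyticAt_snd.mul h1).congr (Eventually.of_forall fun p => ?_)
  have : ((0, p.2) : ℂ × ℂ) = p.2 • ((0, 1) : ℂ × ℂ) := by simp
  dsimp only
  rw [this, map_smul]
  rfl

theorem hasFDerivAt_monomial (a : ℂ) (m n : ℕ) (p : ℂ × ℂ) :
    HasFDerivAt (fun p : ℂ × ℂ => a * p.1 ^ m * p.2 ^ n)
      ((a * (m * p.1 ^ (m - 1)) * p.2 ^ n) • ContinuousLinearMap.fst ℂ ℂ ℂ +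
        (a * p.1 ^ m * (n * p.2 ^ (n - 1))) • ContinuousLinearMap.snd ℂ ℂ ℂ) p := by
  have h1 := (hasFDerivAt_fst (𝕜 := ℂ) (p := p)).pow m
  have h2 := (hasFDerivAt_snd (𝕜 := ℂ) (p := p)).pow n
  convert! (h1.const_mul a).mul h2 using 1
  ext
  · simp; ring
  · simp

/-- The factor m produced by differentiation is absorbed by m ≤ 2^m, at the price of doubling the
radius. -/
theorem natCast_mul_pow_pred_le (m : ℕ) {x ρ : ℝ} (hx : 0 ≤ x) (hρ : 0 < ρ) (hxρ : x ≤ ρ) :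
    m * x ^ (m - 1) ≤ (2 * ρ) ^ m / ρ := by
  rcases m with _ | m
  · simp; positivity
  · rw [Nat.add_sub_cancel, mul_pow, pow_succ ρ, ← mul_assoc, mul_div_assoc, div_self hρ.ne', mul_one]
    gcongr
    exact_mod_cast Nat.lt_two_pow_self.le

theorem IsDoubleSeries.eventually_hasSum_euler {F : ℂ × ℂ → ℂ} {c : ℕ × ℕ → ℂ}
    (h : IsDoubleSeries F c) : ∀ᶠ p : ℂ × ℂ in 𝓝 0,
      HasSum (fun k => k.1 * c k * p.1 ^ k.1 * p.2 ^ k.2) (eulerFst F p) ∧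
      HasSum (fun k => k.2 * c k * p.1 ^ k.1 * p.2 ^ k.2) (eulerSnd F p) := by
  obtain ⟨⟨C, R, hC, hR, hc⟩, hF⟩ := h
  -- With this radius R · 2ρ = 1/2, so the differentiated terms are dominated by a geometric double
  -- series of ratio 1/2.
  set ρ : ℝ := 1 / (4 * R) with hρ
  have hρ0 : 0 < ρ := by positivity
  set D : ℂ × ℂ → ℕ × ℕ → (ℂ × ℂ →L[ℂ] ℂ) := fun p k =>
    ((c k * (k.1 * p.1 ^ (k.1 - 1)) * p.2 ^ k.2) • ContinuousLinearMap.fst ℂ ℂ ℂ +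
        (c k * p.1 ^ k.1 * (k.2 * p.2 ^ (k.2 - 1))) • ContinuousLinearMap.snd ℂ ℂ ℂ) with hD
  have hbound : ∀ k, ∀ p ∈ Metric.ball (0 : ℂ × ℂ) ρ, ‖D p k‖ ≤ (2 * C / ρ) * (1 / 2) ^ (k.1 + k.2) := by
    intro k p hp
    have hp : ‖p‖ ≤ ρ := by simpa using (Metric.mem_ball.1 hp).le
    have h1 : ‖p.1‖ ≤ ρ := (norm_fst_le p).trans hp
    have h2 : ‖p.2‖ ≤ ρ := (norm_snd_le p).trans hp
    have e : C * R ^ (k.1 + k.2) * ((2 * ρ) ^ k.1 * (2 * ρ) ^ k.2) = C * (1 / 2) ^ (k.1 + k.2) := by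
      rw [← pow_add, mul_assoc, ← mul_pow]
      congr 2
      rw [hρ]; field_simp; norm_num
    have hck := hc k
    have t1 : ‖(c k * (k.1 * p.1 ^ (k.1 - 1)) * p.2 ^ k.2) • ContinuousLinearMap.fst ℂ ℂ ℂ‖ ≤
        C / ρ * (1 / 2) ^ (k.1 + k.2) := by
      rw [norm_smul, norm_mul, norm_mul, norm_mul, norm_pow, norm_pow, Complex.norm_natCast]
      calc _ ≤ (C * R ^ (k.1 + k.2)) * ((2 * ρ) ^ k.1 / ρ) * (2 * ρ) ^ k.2 * 1 := by
            gcongr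
            · exact natCast_mul_pow_pred_le _ (norm_nonneg _) hρ0 h1
            · linarith
            · exact ContinuousLinearMap.norm_fst_le ..
        _ = (C * R ^ (k.1 + k.2) * ((2 * ρ) ^ k.1 * (2 * ρ) ^ k.2)) / ρ := by ring
        _ = _ := by rw [e]; ring
    have t2 : ‖(c k * p.1 ^ k.1 * (k.2 * p.2 ^ (k.2 - 1))) • ContinuousLinearMap.snd ℂ ℂ ℂ‖ ≤
        C / ρ * (1 / 2) ^ (k.1 + k.2) := by
      rw [norm_smul, norm_mul, norm_mul, norm_mul, norm_pow, norm_pow, Complex.norm_natCast]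
      calc _ ≤ (C * R ^ (k.1 + k.2)) * (2 * ρ) ^ k.1 * ((2 * ρ) ^ k.2 / ρ) * 1 := by
            gcongr
            · linarith
            · exact natCast_mul_pow_pred_le _ (norm_nonneg _) hρ0 h2
            · exact ContinuousLinearMap.norm_snd_le ..
        _ = (C * R ^ (k.1 + k.2) * ((2 * ρ) ^ k.1 * (2 * ρ) ^ k.2)) / ρ := by ring
        _ = _ := by rw [e]; ring
    refine (norm_add_le _ _).trans ((add_le_add t1 t2).trans (le_of_eq ?_))
    ring
  have hu := summable_geometric_double (2 * C / ρ) (s := 1 / 2) (by norm_num) (by norm_num)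
  have hball : ∀ᶠ p : ℂ × ℂ in 𝓝 0, p ∈ Metric.ball (0 : ℂ × ℂ) ρ := Metric.ball_mem_nhds _ hρ0
  filter_upwards [hball, hF.eventually_nhds] with p hp hFp
  have hder := hasFDerivAt_tsum_of_isPreconnected hu Metric.isOpen_ball
    (convex_ball (0 : ℂ × ℂ) ρ).isPreconnected
    (fun k p _ => hasFDerivAt_monomial (c k) k.1 k.2 p) hbound
    (x₀ := p) hp hFp.self_of_nhds.summable hp
  have hder' : HasFDerivAt F (∑' k, D p k) p :=
    hder.congr_of_eventuallyEq (hFp.mono fun q hq => hq.tsum_eq.symm)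
  have hsD : HasSum (D p) (∑' k, D p k) :=
    (Summable.of_norm_bounded hu fun k => hbound k p hp).hasSum
  have pw : ∀ (m : ℕ) (z : ℂ), (m : ℂ) * z ^ (m - 1) * z = m * z ^ m := by
    intro m z
    rcases m with _ | m
    · simp
    · rw [Nat.add_sub_cancel, mul_assoc, ← pow_succ]
  constructor
  · rw [eulerFst, hder'.fderiv]
    convert! hsD.mapL (ContinuousLinearMap.apply ℂ ℂ ((p.1, 0) : ℂ × ℂ)) using 2 with k
    simp [hD]
    linear_combination -c k * p.2 ^ k.2 * pw k.1 p.1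
  · rw [eulerSnd, hder'.fderiv]
    convert! hsD.mapL (ContinuousLinearMap.apply ℂ ℂ ((0, p.2) : ℂ × ℂ)) using 2 with k
    simp [hD]
    linear_combination -c k * p.1 ^ k.1 * pw k.2 p.2

theorem IsDoubleSeries.eulerFst {F : ℂ × ℂ → ℂ} {c : ℕ × ℕ → ℂ} (h : IsDoubleSeries F c) :
    IsDoubleSeries (eulerFst F) (fun k => k.1 * c k) := by
  obtain ⟨C, R, hC, hR, hc⟩ := h.1
  refine ⟨⟨C, 2 * R, hC, by linarith, fun k => ?_⟩, h.eventually_hasSum_euler.mono fun _ h => h.1⟩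
  rw [norm_mul, Complex.norm_natCast, mul_pow, mul_left_comm]
  gcongr
  · calc (k.1 : ℝ) ≤ 2 ^ k.1 := by exact_mod_cast Nat.lt_two_pow_self.le
      _ ≤ 2 ^ (k.1 + k.2) := by gcongr <;> simp
  · exact hc k

theorem IsDoubleSeries.eulerSnd {F : ℂ × ℂ → ℂ} {c : ℕ × ℕ → ℂ} (h : IsDoubleSeries F c) :
    IsDoubleSeries (eulerSnd F) (fun k => k.2 * c k) := by
  obtain ⟨C, R, hC, hR, hc⟩ := h.1
  refine ⟨⟨C, 2 * R, hC, by linarith, fun k => ?_⟩, h.eventually_hasSum_euler.mono fun _ h => h.2⟩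
  rw [norm_mul, Complex.norm_natCast, mul_pow, mul_left_comm]
  gcongr
  · calc (k.2 : ℝ) ≤ 2 ^ k.2 := by exact_mod_cast Nat.lt_two_pow_self.le
      _ ≤ 2 ^ (k.1 + k.2) := by gcongr <;> simp
  · exact hc k

namespace EulerAt

variable {F G : ℂ × ℂ → ℂ} {p : ℂ × ℂ} {A B A' B' : ℂ}

theorem const (a : ℂ) (p : ℂ × ℂ) : EulerAt (fun _ => a) p 0 0 :=
  ⟨0, hasFDerivAt_const a p, by simp, by simp⟩

theorem fst (p : ℂ × ℂ) : EulerAt (fun p => p.1) p p.1 0 :=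
  ⟨.fst ℂ ℂ ℂ, hasFDerivAt_fst, by simp, by simp⟩

theorem snd (p : ℂ × ℂ) : EulerAt (fun p => p.2) p 0 p.2 :=
  ⟨.snd ℂ ℂ ℂ, hasFDerivAt_snd, by simp, by simp⟩

theorem add (hF : EulerAt F p A B) (hG : EulerAt G p A' B') :
    EulerAt (fun p => F p + G p) p (A + A') (B + B') := by
  obtain ⟨L, hL, rfl, rfl⟩ := hF
  obtain ⟨M, hM, rfl, rfl⟩ := hG
  exact ⟨L + M, hL.add hM, by simp, by simp⟩

theorem mul (hF : EulerAt F p A B) (hG : EulerAt G p A' B') :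
    EulerAt (fun p => F p * G p) p (A * G p + F p * A') (B * G p + F p * B') := by
  obtain ⟨L, hL, rfl, rfl⟩ := hF
  obtain ⟨M, hM, rfl, rfl⟩ := hG
  exact ⟨_, hL.mul hM, by simp; ring, by simp; ring⟩

theorem const_mul (a : ℂ) (hF : EulerAt F p A B) :
    EulerAt (fun p => a * F p) p (a * A) (a * B) := by
  simpa using (const a p).mul hF

theorem sub (hF : EulerAt F p A B) (hG : EulerAt G p A' B') :
    EulerAt (fun p => F p - G p) p (A - A') (B - B') := by
  simpa only [neg_one_mul, ← sub_eq_add_neg] using hF.add (hG.const_mul (-1))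

theorem scomp {h : ℂ → ℂ} {d : ℂ} (hG : EulerAt G p A B) (hh : HasDerivAt h d (G p)) :
    EulerAt (fun p => h (G p)) p (d * A) (d * B) := by
  obtain ⟨L, hL, rfl, rfl⟩ := hG
  exact ⟨_, hh.comp_hasFDerivAt p hL, by simp, by simp⟩

theorem inv (hG : EulerAt G p A B) (h0 : G p ≠ 0) :
    EulerAt (fun p => (G p)⁻¹) p (-A / G p ^ 2) (-B / G p ^ 2) := by
  convert! hG.scomp (hasDerivAt_inv h0) using 1 <;> field_simp

theorem div (hF : EulerAt F p A B) (hG : EulerAt G p A' B') (h0 : G p ≠ 0) :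
    EulerAt (fun p => F p / G p) p ((A * G p - F p * A') / G p ^ 2)
      ((B * G p - F p * B') / G p ^ 2) := by
  convert! hF.mul (hG.inv h0) using 1 <;> field_simp <;> ring

theorem pow (hG : EulerAt G p A B) (n : ℕ) :
    EulerAt (fun p => G p ^ n) p (n * G p ^ (n - 1) * A) (n * G p ^ (n - 1) * B) :=
  hG.scomp (hasDerivAt_pow n (G p))

/-- Chain rule for the Euler derivatives along a map `p ↦ (X p, Y p)`. -/
theorem comp_prodMk {X Y : ℂ × ℂ → ℂ} {H : ℂ × ℂ → ℂ} {a b a' b' : ℂ}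
    (hX : EulerAt X p (X p * a) (X p * b)) (hY : EulerAt Y p (Y p * a') (Y p * b'))
    (hH : EulerAt H (X p, Y p) A B) :
    EulerAt (fun p => H (X p, Y p)) p (a * A + a' * B) (b * A + b' * B) := by
  obtain ⟨L, hL, hLa, hLb⟩ := hX
  obtain ⟨M, hM, hMa, hMb⟩ := hY
  obtain ⟨N, hN, rfl, rfl⟩ := hH
  -- Since the derivatives of X and Y are given as multiples of X and Y, the derivative of H is only
  -- evaluated at combinations of (X, 0) and (0, Y), which yield its Euler derivatives.
  have key : ∀ s t : ℂ, N (X p * s, Y p * t) = s * N (X p, 0) + t * N (0, Y p) := by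
    intro s t
    rw [← smul_eq_mul s, ← smul_eq_mul t, ← map_smul, ← map_smul, ← map_add]
    simp [mul_comm]
  refine ⟨_, hN.comp p (hL.prodMk hM), ?_, ?_⟩
  · rw [ContinuousLinearMap.comp_apply, ContinuousLinearMap.prod_apply, hLa, hMa, key]
  · rw [ContinuousLinearMap.comp_apply, ContinuousLinearMap.prod_apply, hLb, hMb, key]

theorem congr_of_eventuallyEq (hF : EulerAt F p A B) (h : G =ᶠ[𝓝 p] F) : EulerAt G p A B := by
  obtain ⟨L, hL, hA, hB⟩ := hF
  exact ⟨L, hL.congr_of_eventuallyEq h, hA, hB⟩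

theorem unique (h : EulerAt F p A B) (h' : EulerAt F p A' B') : A = A' ∧ B = B' :=
  ⟨h.eq.1.symm.trans h'.eq.1, h.eq.2.symm.trans h'.eq.2⟩

end EulerAt

/-! ### Gauss' function and its differential equation -/

section Hypergeometric

variable {a b c : ℂ}

theorem ordinaryHypergeometricCoefficient_succ (hc : ∀ k : ℕ, c ≠ -(k : ℂ)) (n : ℕ) :
    ordinaryHypergeometricCoefficient a b c (n + 1) * ((n + 1) * (c + n)) =
      ordinaryHypergeometricCoefficient a b c n * ((a + n) * (b + n)) := by
  have h1 : c + n ≠ 0 := fun h => hc n (eq_neg_of_add_eq_zero_left h)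
  have h2 : (n : ℂ) + 1 ≠ 0 := Nat.cast_add_one_ne_zero n
  have h3 : (n.factorial : ℂ) ≠ 0 := by exact_mod_cast n.factorial_ne_zero
  simp only [ordinaryHypergeometricCoefficient, ascPochhammer_succ_eval, Nat.factorial_succ,
    Nat.cast_mul, Nat.cast_add, Nat.cast_one, mul_inv]
  field_simp

/-- The ratio of consecutive coefficients tends to 1, hence is bounded. This also covers the
terminating series. -/
theorem exists_norm_hypergeometricCoefficient_le (hc : ∀ k : ℕ, c ≠ -(k : ℂ)) :
    ∃ R : ℝ, 1 ≤ R ∧ ∀ n, ‖ordinaryHypergeometricCoefficient a b c n‖ ≤ R ^ n := by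
  have hlim : Tendsto (fun k : ℕ => ((a + 1 * k) / (c + 1 * k)) * ((b + 1 * k) / (1 + 1 * k))) atTop
      (𝓝 (1 / 1 * (1 / 1))) :=
    (tendsto_add_mul_div_add_mul_atTop_nhds a c (1 : ℂ) one_ne_zero).mul
      (tendsto_add_mul_div_add_mul_atTop_nhds b (1 : ℂ) (1 : ℂ) one_ne_zero)
  obtain ⟨R, hR⟩ := hlim.norm.bddAbove_range
  refine ⟨max 1 R, le_max_left _ _, fun n => ?_⟩
  induction n with
  | zero => simp [ordinaryHypergeometricCoefficient]
  | succ n ih =>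
    have h1 : c + n ≠ 0 := fun h => hc n (eq_neg_of_add_eq_zero_left h)
    have h2 : (1 : ℂ) + n ≠ 0 := by
      rw [add_comm]
      exact Nat.cast_add_one_ne_zero n
    have e : ordinaryHypergeometricCoefficient a b c (n + 1) =
        ordinaryHypergeometricCoefficient a b c n *
          (((a + 1 * n) / (c + 1 * n)) * ((b + 1 * n) / (1 + 1 * n))) := by
      have := ordinaryHypergeometricCoefficient_succ (a := a) (b := b) hc n
      rw [one_mul]
      field_simp
      linear_combination this
    rw [e, norm_mul, pow_succ]
    gcongr
    exact (hR ⟨n, rfl⟩).trans (le_max_right _ _)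

theorem eventually_hasSum_hypergeometric (hc : ∀ k : ℕ, c ≠ -(k : ℂ)) :
    ∀ᶠ z : ℂ in 𝓝 0, HasSum (fun n => ordinaryHypergeometricCoefficient a b c n * z ^ n)
      (ordinaryHypergeometric a b c z) := by
  obtain ⟨R, hR, hb⟩ := exists_norm_hypergeometricCoefficient_le (a := a) (b := b) hc
  filter_upwards [Metric.closedBall_mem_nhds (0 : ℂ) (show 0 < 1 / (2 * R) by positivity)] with z hz
  have hz : ‖z‖ ≤ 1 / (2 * R) := by simpa using hz
  rw [ordinaryHypergeometric_eq_tsum]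
  refine Summable.hasSum (.of_norm_bounded
    (summable_geometric_of_lt_one (r := 1 / 2) (by norm_num) (by norm_num)) fun n => ?_)
  calc ‖ordinaryHypergeometricCoefficient a b c n * z ^ n‖
      ≤ R ^ n * (1 / (2 * R)) ^ n := by
        rw [norm_mul, norm_pow]
        gcongr
        exact hb n
    _ = (1 / 2) ^ n := by
        rw [← mul_pow]
        congr 1
        field_simp

theorem analyticAt_hypergeometric (hc : ∀ k : ℕ, c ≠ -(k : ℂ)) :
    AnalyticAt ℂ (fun z : ℂ => ordinaryHypergeometric a b c z) 0 := by
  refine ⟨FormalMultilinearSeries.ofScalars ℂ (ordinaryHypergeometricCoefficient a b c), ?_⟩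
  rw [hasFPowerSeriesAt_iff]
  filter_upwards [eventually_hasSum_hypergeometric (a := a) (b := b) hc] with z hz
  simpa [FormalMultilinearSeries.coeff_ofScalars, mul_comm] using hz

theorem isDoubleSeries_hypergeometric_snd (hc : ∀ k : ℕ, c ≠ -(k : ℂ)) :
    IsDoubleSeries (fun p => ordinaryHypergeometric a b c p.2)
      (fun k => if k.1 = 0 then ordinaryHypergeometricCoefficient a b c k.2 else 0) := by
  obtain ⟨R, hR, hb⟩ := exists_norm_hypergeometricCoefficient_le (a := a) (b := b) hc
  refine ⟨⟨1, R, zero_le_one, hR, fun k => ?_⟩, ?_⟩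
  · dsimp only
    split_ifs with h
    · simpa [h] using hb k.2
    · simp only [norm_zero]; positivity
  · have h := (continuous_snd (X := ℂ) (Y := ℂ)).tendsto 0
    filter_upwards [h.eventually (eventually_hasSum_hypergeometric (a := a) (b := b) hc)] with p hp
    have hinj : Function.Injective (fun n : ℕ => (0, n)) := fun m n h => by simpa using h
    rw [← hinj.hasSum_iff]
    · simpa [Function.comp_def] using hp
    · rintro ⟨m, n⟩ hk
      have : m ≠ 0 := fun hm => hk ⟨n, by simp [hm]⟩
      simp [this]

theorem eulerSnd_comp_snd {f : ℂ → ℂ} {p : ℂ × ℂ} (hf : DifferentiableAt ℂ f p.2) :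
    eulerSnd (fun p => f p.2) p = p.2 * deriv f p.2 :=
  ((EulerAt.snd p).scomp hf.hasDerivAt).eq.2.trans (mul_comm _ _)

/-- Gauss' equation `ϑ(ϑ + c - 1)f = z(ϑ + a)(ϑ + b)f`, as a system for `f` and `ϑf`. -/
theorem exists_euler_hypergeometric (a b : ℂ) (hc : ∀ k : ℕ, c ≠ -(k : ℂ)) :
    ∃ f₁ : ℂ → ℂ, ∀ᶠ z : ℂ in 𝓝 0,
      (∃ d, HasDerivAt (fun z : ℂ => ordinaryHypergeometric a b c z) d z ∧ z * d = f₁ z) ∧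
      ∃ e, HasDerivAt f₁ e z ∧ (1 - z) * (z * e) =
        z * ((a + b) * f₁ z + a * b * ordinaryHypergeometric a b c z) - (c - 1) * f₁ z := by
  have hf := analyticAt_hypergeometric (a := a) (b := b) hc
  set f : ℂ → ℂ := fun z => ordinaryHypergeometric a b c z with hfdef
  set f₁ : ℂ → ℂ := fun z => z * deriv f z with hf₁
  have hf1 : AnalyticAt ℂ f₁ 0 := analyticAt_id.mul hf.deriv
  have hsnd := (continuous_snd (X := ℂ) (Y := ℂ)).tendsto 0
  -- Regarded as a function of the second coordinate alone, f falls under the calculus of double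
  -- series, and Gauss' equation becomes the recurrence of its coefficients.
  have h0 : IsDoubleSeries (fun p => f p.2) _ := isDoubleSeries_hypergeometric_snd (a := a) (b := b) hc
  have h1 := h0.eulerSnd.congr_left (G := fun p => f₁ p.2) <| by
    filter_upwards [hsnd.eventually hf.eventually_analyticAt] with p hp
    exact eulerSnd_comp_snd hp.differentiableAt
  have h2 := h1.eulerSnd.congr_left (G := fun p => p.2 * deriv f₁ p.2) <| by
    filter_upwards [hsnd.eventually hf1.eventually_analyticAt] with p hp
    exact eulerSnd_comp_snd hp.differentiableAt
  have hode := (h2.add (h1.const_mul (c - 1))).sub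
    (h2.add ((h1.const_mul (a + b)).add (h0.const_mul (a * b)))).mul_snd
  have hode0 : ∀ᶠ p : ℂ × ℂ in 𝓝 0, p.2 * deriv f₁ p.2 + (c - 1) * f₁ p.2 -
      p.2 * (p.2 * deriv f₁ p.2 + ((a + b) * f₁ p.2 + a * b * f p.2)) = 0 := by
    filter_upwards [hode.2] with p hp
    refine hp.unique ?_
    convert! hasSum_zero (α := ℂ) (β := ℕ × ℕ) using 2 with k
    obtain ⟨m, n⟩ := k
    rw [mul_assoc]
    refine mul_eq_zero_of_left ?_ _
    rcases m with _ | m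
    · rcases n with _ | n
      · simp
      · have := ordinaryHypergeometricCoefficient_succ (a := a) (b := b) hc n
        simp only [if_true, Nat.add_eq_zero_iff, one_ne_zero, and_false, if_false,
          Nat.add_sub_cancel, Nat.cast_add, Nat.cast_one]
        linear_combination this
    · simp
  have hline : Tendsto (fun z : ℂ => ((0, z) : ℂ × ℂ)) (𝓝 0) (𝓝 0) := by
    have : Continuous (fun z : ℂ => ((0, z) : ℂ × ℂ)) := by fun_prop
    exact this.tendsto 0
  refine ⟨f₁, ?_⟩
  filter_upwards [hline.eventually hode0, hf.eventually_analyticAt, hf1.eventually_analyticAt]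
    with z hz h1 h2
  refine ⟨⟨_, h1.differentiableAt.hasDerivAt, rfl⟩, _, h2.differentiableAt.hasDerivAt, ?_⟩
  change _ = z * ((a + b) * f₁ z + a * b * f z) - (c - 1) * f₁ z
  linear_combination hz

end Hypergeometric

/-! ### Bivariate polynomials and the logarithmic Jacobian of the substitution -/

/-- The polynomial in two variables given by a list of coefficients and exponents. -/
def bivariate (l : List (ℂ × ℕ × ℕ)) (p : ℂ × ℂ) : ℂ :=
  (l.map fun t => t.1 * p.1 ^ t.2.1 * p.2 ^ t.2.2).sum

/-- The coefficients of the Euler derivative `x ∂/∂x` of a polynomial. -/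
def bivariateFst (l : List (ℂ × ℕ × ℕ)) : List (ℂ × ℕ × ℕ) := l.map fun t => (t.2.1 * t.1, t.2)

/-- The coefficients of the Euler derivative `y ∂/∂y` of a polynomial. -/
def bivariateSnd (l : List (ℂ × ℕ × ℕ)) : List (ℂ × ℕ × ℕ) := l.map fun t => (t.2.2 * t.1, t.2)

theorem eulerAt_bivariate (l : List (ℂ × ℕ × ℕ)) (p : ℂ × ℂ) :
    EulerAt (bivariate l) p (bivariate (bivariateFst l) p) (bivariate (bivariateSnd l) p) := by
  have pw : ∀ (m : ℕ) (z : ℂ), (m : ℂ) * z ^ (m - 1) * z = m * z ^ m := by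
    intro m z
    rcases m with _ | m
    · simp
    · rw [Nat.add_sub_cancel, mul_assoc, ← pow_succ]
  induction l with
  | nil => simpa [bivariate, bivariateFst, bivariateSnd] using! EulerAt.const 0 p
  | cons t l ih =>
    have h := ((((EulerAt.fst p).pow t.2.1).const_mul t.1).mul ((EulerAt.snd p).pow t.2.2)).add ih
    have hl : bivariate (t :: l) = fun p => t.1 * p.1 ^ t.2.1 * p.2 ^ t.2.2 + bivariate l p := by
      funext p
      simp [bivariate]
    rw [hl]
    convert! h using 1
    · simp only [bivariate, bivariateFst, List.map_cons, List.sum_cons]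
      linear_combination -t.1 * p.2 ^ t.2.2 * pw t.2.1 p.1
    · simp only [bivariate, bivariateSnd, List.map_cons, List.sum_cons]
      linear_combination -t.1 * p.1 ^ t.2.1 * pw t.2.2 p.2

/-- The first argument of `H₅` as a function of `(x, y)`. -/
noncomputable def hornX (p : ℂ × ℂ) : ℂ := p.1 * (p.2 - 1) ^ 2 / (4 * (3 * p.1 * p.2 - 1) ^ 2)

/-- The second argument of `H₅` as a function of `(x, y)`. -/
noncomputable def hornY (p : ℂ × ℂ) : ℂ :=
  4 * (p.1 * p.2 ^ 2 + 1) * (p.1 + 1) * p.2 / ((3 * p.1 * p.2 - 1) * (p.2 - 1) ^ 2)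

/-- Points where the substitution `(x, y) ↦ (X, Y)` is regular. -/
structure RegularPoint (p : ℂ × ℂ) : Prop where
  xy : 1 - 3 * p.1 * p.2 ≠ 0
  y : 1 - p.2 ≠ 0
  xyy : 1 + p.1 * p.2 ^ 2 ≠ 0
  x : 1 + p.1 ≠ 0
  jac : (1 + p.2) * (1 + p.1 + 8 * p.1 * p.2 + p.1 * p.2 ^ 2 + 9 * p.1 ^ 2 * p.2 ^ 2) ≠ 0

theorem eventually_regularPoint : ∀ᶠ p : ℂ × ℂ in 𝓝 0, RegularPoint p := by
  have h : ∀ f : ℂ × ℂ → ℂ, Continuous f → f 0 ≠ 0 → ∀ᶠ p in 𝓝 0, f p ≠ 0 :=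
    fun f hf h0 => hf.continuousAt.eventually_ne h0
  filter_upwards [h (fun p => 1 - 3 * p.1 * p.2) (by fun_prop) (by simp),
    h (fun p => 1 - p.2) (by fun_prop) (by simp),
    h (fun p => 1 + p.1 * p.2 ^ 2) (by fun_prop) (by simp),
    h (fun p => 1 + p.1) (by fun_prop) (by simp),
    h (fun p => (1 + p.2) * (1 + p.1 + 8 * p.1 * p.2 + p.1 * p.2 ^ 2 + 9 * p.1 ^ 2 * p.2 ^ 2))
      (by fun_prop) (by simp)] with p h1 h2 h3 h4 h5
  exact ⟨h1, h2, h3, h4, h5⟩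

theorem eulerAt_hornX {p : ℂ × ℂ} (hp : RegularPoint p) :
    EulerAt hornX p (hornX p * ((1 + 3 * p.1 * p.2) / (1 - 3 * p.1 * p.2)))
      (hornX p * (2 * p.2 * (3 * p.1 - 1) / ((1 - 3 * p.1 * p.2) * (1 - p.2)))) := by
  have h1 := hp.xy
  have h1' : 3 * p.1 * p.2 - 1 ≠ 0 := by rw [← neg_sub]; exact neg_ne_zero.2 h1
  have h2 := hp.y
  have h := ((EulerAt.fst p).mul (((EulerAt.snd p).sub (.const 1 p)).pow 2)).div
    ((((((EulerAt.fst p).const_mul 3).mul (.snd p)).sub (.const 1 p)).pow 2).const_mul 4)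
    (by simpa using h1')
  convert! h using 1
  · simp only [hornX]
    obtain ⟨x, y⟩ := p
    simp only at *
    push_cast
    -- The denominators become single nonzero atoms, with one sign convention for 1 - 3xy and 3xy -
    -- 1, and are expanded again only after they have been cleared.
    obtain ⟨d, hd⟩ : ∃ d, 1 - 3 * x * y = d := ⟨_, rfl⟩
    have hd' : 3 * x * y - 1 = -d := by rw [← hd]; ring
    obtain ⟨e, he⟩ : ∃ e, 1 - y = e := ⟨_, rfl⟩
    have he' : y - 1 = -e := by rw [← he]; ring
    rw [hd] at h1
    rw [he] at h2
    rw [hd, hd', he']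
    field_simp
    subst hd he
    ring
  · simp only [hornX]
    obtain ⟨x, y⟩ := p
    simp only at *
    push_cast
    obtain ⟨d, hd⟩ : ∃ d, 1 - 3 * x * y = d := ⟨_, rfl⟩
    have hd' : 3 * x * y - 1 = -d := by rw [← hd]; ring
    obtain ⟨e, he⟩ : ∃ e, 1 - y = e := ⟨_, rfl⟩
    have he' : y - 1 = -e := by rw [← he]; ring
    rw [hd] at h1
    rw [he] at h2
    rw [hd, hd', he', he]
    field_simp
    subst hd he
    ring

theorem eulerAt_hornY {p : ℂ × ℂ} (hp : RegularPoint p) :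
    EulerAt hornY p
      (hornY p * (p.1 * p.2 ^ 2 / (1 + p.1 * p.2 ^ 2) + p.1 / (1 + p.1) +
        3 * p.1 * p.2 / (1 - 3 * p.1 * p.2)))
      (hornY p * (1 + 2 * (p.1 * p.2 ^ 2) / (1 + p.1 * p.2 ^ 2) +
        3 * p.1 * p.2 / (1 - 3 * p.1 * p.2) + 2 * p.2 / (1 - p.2))) := by
  have h1 := hp.xy
  have h1' : 3 * p.1 * p.2 - 1 ≠ 0 := by rw [← neg_sub]; exact neg_ne_zero.2 h1
  have h2 := hp.y
  have h2' : p.2 - 1 ≠ 0 := by rw [← neg_sub]; exact neg_ne_zero.2 h2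
  have h3 := hp.xyy
  have h4 := hp.x
  have h := ((((((EulerAt.fst p).mul ((EulerAt.snd p).pow 2)).add (.const 1 p)).const_mul 4).mul
    ((EulerAt.fst p).add (.const 1 p))).mul (.snd p)).div
    (((((EulerAt.fst p).const_mul 3).mul (.snd p)).sub (.const 1 p)).mul
      (((EulerAt.snd p).sub (.const 1 p)).pow 2)) (mul_ne_zero h1' (pow_ne_zero 2 h2'))
  convert! h using 1
  · simp only [hornY]
    obtain ⟨x, y⟩ := p
    simp only at *
    push_cast
    obtain ⟨d, hd⟩ : ∃ d, 1 - 3 * x * y = d := ⟨_, rfl⟩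
    have hd' : 3 * x * y - 1 = -d := by rw [← hd]; ring
    obtain ⟨e, he⟩ : ∃ e, 1 - y = e := ⟨_, rfl⟩
    have he' : y - 1 = -e := by rw [← he]; ring
    obtain ⟨r, hr⟩ : ∃ r, 1 + x * y ^ 2 = r := ⟨_, rfl⟩
    obtain ⟨s, hs⟩ : ∃ s, 1 + x = s := ⟨_, rfl⟩
    rw [hd] at h1
    rw [he] at h2
    rw [hr] at h3
    rw [hs] at h4
    simp only [hd, hd', he', hr, hs]
    field_simp
    subst hd he hr hs
    ring
  · simp only [hornY]
    obtain ⟨x, y⟩ := p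
    simp only at *
    push_cast
    obtain ⟨d, hd⟩ : ∃ d, 1 - 3 * x * y = d := ⟨_, rfl⟩
    have hd' : 3 * x * y - 1 = -d := by rw [← hd]; ring
    obtain ⟨e, he⟩ : ∃ e, 1 - y = e := ⟨_, rfl⟩
    have he' : y - 1 = -e := by rw [← he]; ring
    obtain ⟨r, hr⟩ : ∃ r, 1 + x * y ^ 2 = r := ⟨_, rfl⟩
    obtain ⟨s, hs⟩ : ∃ s, 1 + x = s := ⟨_, rfl⟩
    rw [hd] at h1
    rw [he] at h2
    rw [hr] at h3
    rw [hs] at h4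
    simp only [hd, hd', he', he, hr]
    field_simp
    subst hd he hr hs
    ring

/-- The Euler derivatives in `(X, Y)` in terms of those in `(x, y)`. -/
theorem euler_of_comp_horn {p : ℂ × ℂ} (hp : RegularPoint p) {H : ℂ × ℂ → ℂ} {A B : ℂ}
    (hH : DifferentiableAt ℂ H (hornX p, hornY p))
    (hHp : EulerAt (fun p => H (hornX p, hornY p)) p A B) :
    eulerFst H (hornX p, hornY p) *
        ((1 + p.2) * (1 + p.1 + 8 * p.1 * p.2 + p.1 * p.2 ^ 2 + 9 * p.1 ^ 2 * p.2 ^ 2)) =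
      (1 + p.1) * (1 + p.2 - 3 * p.1 * p.2 ^ 2 - p.1 * p.2 ^ 3 - 6 * p.1 ^ 2 * p.2 ^ 3) * A +
      (-p.1 - 2 * p.1 * p.2 + 2 * p.1 * p.2 ^ 2 + p.1 * p.2 ^ 3 - 2 * p.1 ^ 2 * p.2 ^ 2 +
        2 * p.1 ^ 2 * p.2 ^ 3 + 3 * p.1 ^ 3 * p.2 ^ 3 - 3 * p.1 ^ 3 * p.2 ^ 4) * B ∧
    eulerSnd H (hornX p, hornY p) *
        ((1 + p.2) * (1 + p.1 + 8 * p.1 * p.2 + p.1 * p.2 ^ 2 + 9 * p.1 ^ 2 * p.2 ^ 2)) =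
      (1 + p.1) * (2 * p.2 - 6 * p.1 * p.2 + 2 * p.1 * p.2 ^ 3 - 6 * p.1 ^ 2 * p.2 ^ 3) * A +
      (1 - p.2 + p.1 + 2 * p.1 * p.2 - 2 * p.1 * p.2 ^ 2 - p.1 * p.2 ^ 3 + 3 * p.1 ^ 2 * p.2 -
        2 * p.1 ^ 2 * p.2 ^ 2 + 2 * p.1 ^ 2 * p.2 ^ 3 - 3 * p.1 ^ 2 * p.2 ^ 4 +
        3 * p.1 ^ 3 * p.2 ^ 3 - 3 * p.1 ^ 3 * p.2 ^ 4) * B := by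
  -- The chain rule expresses A and B through the Euler derivatives of H. After this substitution
  -- the claim says that the displayed matrix inverts the logarithmic Jacobian up to the factor on
  -- the left.
  obtain ⟨rfl, rfl⟩ := hHp.unique
    ((eulerAt_hornX hp).comp_prodMk (eulerAt_hornY hp) hH.eulerAt)
  have h1 := hp.xy
  have h2 := hp.y
  have h3 := hp.xyy
  have h4 := hp.x
  generalize eulerFst H (hornX p, hornY p) = U
  generalize eulerSnd H (hornX p, hornY p) = V
  obtain ⟨x, y⟩ := p
  simp only at *
  obtain ⟨d, hd⟩ : ∃ d, 1 - 3 * x * y = d := ⟨_, rfl⟩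
  obtain ⟨e, he⟩ : ∃ e, 1 - y = e := ⟨_, rfl⟩
  obtain ⟨r, hr⟩ : ∃ r, 1 + x * y ^ 2 = r := ⟨_, rfl⟩
  obtain ⟨s, hs⟩ : ∃ s, 1 + x = s := ⟨_, rfl⟩
  rw [hd] at h1 ⊢
  rw [he] at h2 ⊢
  rw [hr] at h3 ⊢
  rw [hs] at h4 ⊢
  constructor
  · field_simp
    subst hd he hr hs
    ring
  · field_simp
    subst hd he hr hs
    ring

/-! ### Horn's equation in the span of PFG, PF₁G, PFG₁, PF₁G₁ -/

/-- Euler derivatives of the prefactor `P`, of `F = f(-xy²)`, `F₁ = (ϑf)(-xy²)`, and of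
`G = g(-x)`, `G₁ = (ϑg)(-x)`, where `f` and `g` are the two Gauss functions of the product. -/
structure EulerBasis (q : ℂ) (P F F₁ G G₁ : ℂ × ℂ → ℂ) (p : ℂ × ℂ) : Prop where
  eP : EulerAt P p (P p * (-(3 * q * p.1 * p.2) / (1 - 3 * p.1 * p.2)))
    (P p * (-(3 * q * p.1 * p.2) / (1 - 3 * p.1 * p.2) - (2 * q - 1) * p.2 / (1 - p.2)))
  eF : EulerAt F p (F₁ p) (2 * F₁ p)
  eF₁ : ∃ e, EulerAt F₁ p e (2 * e) ∧ (1 + p.1 * p.2 ^ 2) * e =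
    -(p.1 * p.2 ^ 2) * ((3 * q - 1 / 2) * F₁ p + (3 / 2 * q - 1 / 2) * (3 / 2 * q) * F p) -
      (q - 1 / 2) * F₁ p
  eG : EulerAt G p (G₁ p) 0
  eG₁ : ∃ e, EulerAt G₁ p e 0 ∧ (1 + p.1) * e =
    -p.1 * ((q + 1 / 2) * G₁ p + 1 / 2 * q * (1 / 2 * q + 1 / 2) * G p) - (1 / 2 - q) * G₁ p

section EulerBasis

variable {q : ℂ} {P F F₁ G G₁ : ℂ × ℂ → ℂ} {p : ℂ × ℂ}

/-- Euler derivatives in `(X, Y)` of a combination of `P F G`, `P F₁ G` and `P F G₁`. -/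
theorem EulerBasis.euler_combination (hB : EulerBasis q P F F₁ G G₁ p) (hp : RegularPoint p)
    {u v w : ℂ × ℂ → ℂ} {a b a' b' a'' b'' : ℂ} (hu : EulerAt u p a b) (hv : EulerAt v p a' b')
    (hw : EulerAt w p a'' b'') {H : ℂ × ℂ → ℂ} (hH : DifferentiableAt ℂ H (hornX p, hornY p))
    (hHp : ∀ᶠ p in 𝓝 p, H (hornX p, hornY p) =
      P p * (u p * (F p * G p) + v p * (F₁ p * G p) + w p * (F p * G₁ p)))
    {x y D aX bX aY bY lX lY sX sY gX gY : ℂ} (hx : p.1 = x) (hy : p.2 = y)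
    (hD : D = (1 + y) * (1 + x + 8 * x * y + x * y ^ 2 + 9 * x ^ 2 * y ^ 2))
    (hgX : gX = 1 + y - 3 * x * y ^ 2 - x * y ^ 3 - 6 * x ^ 2 * y ^ 3)
    (hgY : gY = 2 * y - 6 * x * y + 2 * x * y ^ 3 - 6 * x ^ 2 * y ^ 3)
    (haX : aX = (1 + x) * gX) (haY : aY = (1 + x) * gY)
    (hbX : bX = -x - 2 * x * y + 2 * x * y ^ 2 + x * y ^ 3 - 2 * x ^ 2 * y ^ 2 +
      2 * x ^ 2 * y ^ 3 + 3 * x ^ 3 * y ^ 3 - 3 * x ^ 3 * y ^ 4)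
    (hbY : bY = 1 - y + x + 2 * x * y - 2 * x * y ^ 2 - x * y ^ 3 + 3 * x ^ 2 * y -
      2 * x ^ 2 * y ^ 2 + 2 * x ^ 2 * y ^ 3 - 3 * x ^ 2 * y ^ 4 + 3 * x ^ 3 * y ^ 3 -
      3 * x ^ 3 * y ^ 4)
    (hlX : lX = (-1 - q) * x * y + (-3 + 3 * q) * x * y ^ 2 + (-1 + 2 * q) * x * y ^ 3 -
      6 * q * x ^ 2 * y ^ 2 + (-2 - 2 * q) * x ^ 2 * y ^ 3 - 3 * q * x ^ 3 * y ^ 3 +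
      (3 - 9 * q) * x ^ 3 * y ^ 4)
    (hlY : lY = (1 - 2 * q) * y + (1 - 5 * q) * x * y + (3 - 9 * q) * x * y ^ 2 +
      (1 - 2 * q) * x * y ^ 3 - 3 * q * x ^ 2 * y + (3 - 9 * q) * x ^ 2 * y ^ 2 +
      (1 - 5 * q) * x ^ 2 * y ^ 3 + (3 - 9 * q) * x ^ 2 * y ^ 4 - 3 * q * x ^ 3 * y ^ 3 +
      (3 - 9 * q) * x ^ 3 * y ^ 4)
    (hsX : sX = 1 + y - x - 3 * x * y - 6 * x ^ 2 * y ^ 2)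
    (hsY : sY = 2 + 2 * x - 6 * x * y ^ 2 - 6 * x ^ 2 * y ^ 2) :
    eulerFst H (hornX p, hornY p) * D = P p *
      ((aX * a + bX * b + lX * u p - sX * (x * y ^ 2) * ((3 / 2 * q - 1 / 2) * (3 / 2 * q)) * v p
          - gX * x * (1 / 2 * q * (1 / 2 * q + 1 / 2)) * w p) * (F p * G p) +
        (aX * a' + bX * b' + lX * v p + sX * ((1 + x * y ^ 2) * u p -
          (x * y ^ 2 * (3 * q - 1 / 2) + (q - 1 / 2)) * v p)) * (F₁ p * G p) +
        (aX * a'' + bX * b'' + lX * w p + gX * ((1 + x) * u p -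
          (x * (q + 1 / 2) + (1 / 2 - q)) * w p)) * (F p * G₁ p) +
        (aX * v p + sX * (1 + x * y ^ 2) * w p) * (F₁ p * G₁ p)) ∧
    eulerSnd H (hornX p, hornY p) * D = P p *
      ((aY * a + bY * b + lY * u p - sY * (x * y ^ 2) * ((3 / 2 * q - 1 / 2) * (3 / 2 * q)) * v p
          - gY * x * (1 / 2 * q * (1 / 2 * q + 1 / 2)) * w p) * (F p * G p) +
        (aY * a' + bY * b' + lY * v p + sY * ((1 + x * y ^ 2) * u p -
          (x * y ^ 2 * (3 * q - 1 / 2) + (q - 1 / 2)) * v p)) * (F₁ p * G p) +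
        (aY * a'' + bY * b'' + lY * w p + gY * ((1 + x) * u p -
          (x * (q + 1 / 2) + (1 / 2 - q)) * w p)) * (F p * G₁ p) +
        (aY * v p + sY * (1 + x * y ^ 2) * w p) * (F₁ p * G₁ p)) := by
  obtain ⟨e, he, hee⟩ := hB.eF₁
  obtain ⟨e', he', hee'⟩ := hB.eG₁
  have h := hB.eP.mul (((hu.mul (hB.eF.mul hB.eG)).add (hv.mul (he.mul hB.eG))).add
    (hw.mul (hB.eF.mul he')))
  obtain ⟨hA, hB⟩ := euler_of_comp_horn hp hH (h.congr_of_eventuallyEq hHp)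
  have h1 := hp.xy
  have h2 := hp.y
  simp only [hx, hy] at hA hB h1 h2 hee hee'
  -- F depends on xy² only, so its derivatives enter through aX + 2 bX. This is divisible by 1 +
  -- xy², the leading coefficient of the equation for F, just as aX is divisible by 1 + x, that of
  -- the equation for G. Hence Gauss' equation introduces no denominators.
  have dX : aX + 2 * bX = sX * (1 + x * y ^ 2) := by subst_vars; ring
  have dY : aY + 2 * bY = sY * (1 + x * y ^ 2) := by subst_vars; ring
  -- The denominators 1 - 3xy and 1 - y in the logarithmic derivative of P cancel as well.
  have eX : (aX + bX) * (-(3 * q * x * y) / (1 - 3 * x * y)) - bX * ((2 * q - 1) * y / (1 - y)) = lX := by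
    obtain ⟨d, hd⟩ : ∃ d, 1 - 3 * x * y = d := ⟨_, rfl⟩
    obtain ⟨e, he⟩ : ∃ e, 1 - y = e := ⟨_, rfl⟩
    rw [hd] at h1 ⊢
    rw [he] at h2 ⊢
    field_simp
    subst_vars
    ring
  have eY : (aY + bY) * (-(3 * q * x * y) / (1 - 3 * x * y)) - bY * ((2 * q - 1) * y / (1 - y)) = lY := by
    obtain ⟨d, hd⟩ : ∃ d, 1 - 3 * x * y = d := ⟨_, rfl⟩
    obtain ⟨e, he⟩ : ∃ e, 1 - y = e := ⟨_, rfl⟩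
    rw [hd] at h1 ⊢
    rw [he] at h2 ⊢
    field_simp
    subst_vars
    ring
  rw [← hD, ← hgX, ← haX, ← hbX] at hA
  rw [← hD, ← hgY, ← haY, ← hbY] at hB
  constructor
  · rw [hA]
    linear_combination P p * (u p * (F p * G p) + v p * (F₁ p * G p) + w p * (F p * G₁ p)) * eX +
      P p * G p * (u p * F₁ p + v p * e) * dX + P p * w p * F₁ p * G₁ p * dX +
      P p * v p * G p * sX * hee + (P p * (u p * F p * G₁ p + w p * F p * e')) * haX +
      P p * w p * F p * gX * hee'
  · rw [hB]
    linear_combination P p * (u p * (F p * G p) + v p * (F₁ p * G p) + w p * (F p * G₁ p)) * eY +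
      P p * G p * (u p * F₁ p + v p * e) * dY + P p * w p * F₁ p * G₁ p * dY +
      P p * v p * G p * sY * hee + (P p * (u p * F p * G₁ p + w p * F p * e')) * haY +
      P p * w p * F p * gY * hee'

end EulerBasis

/-- The Jacobian factor of the substitution `(x, y) ↦ (X, Y)`. -/
def hornDenom : List (ℂ × ℕ × ℕ) :=
  [(1, 0, 0), (1, 0, 1), (1, 1, 0), (9, 1, 1), (9, 1, 2), (1, 1, 3), (9, 2, 2), (9, 2, 3)]

/-- Numerator of the `P F G`-coefficient of `Y ∂H/∂Y`. -/
def hornSndFG (q : ℂ) : List (ℂ × ℕ × ℕ) :=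
  [(1 - 2 * q, 0, 1), (1 - 5 * q, 1, 1), (3 - 9 * q, 1, 2), (1 - 2 * q, 1, 3), (-3 * q, 2, 1),
    (3 - 9 * q, 2, 2), (1 - 5 * q, 2, 3), (3 - 9 * q, 2, 4), (-3 * q, 3, 3), (3 - 9 * q, 3, 4)]

/-- Numerator of the `P F₁ G`-coefficient of `Y ∂H/∂Y`. -/
def hornSndF₁G : List (ℂ × ℕ × ℕ) :=
  [(2, 0, 0), (2, 1, 0), (-4, 1, 2), (-4, 2, 2), (-6, 2, 4), (-6, 3, 4)]

/-- Numerator of the `P F G₁`-coefficient of `Y ∂H/∂Y`. -/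
def hornSndFG₁ : List (ℂ × ℕ × ℕ) :=
  [(2, 0, 1), (-4, 1, 1), (2, 1, 3), (-6, 2, 1), (-4, 2, 3), (-6, 3, 3)]

/-- Numerator of the `P F G`-coefficient of `(b + Y ∂/∂Y - X ∂/∂X) H`. -/
noncomputable def hornMixFG (q : ℂ) : List (ℂ × ℕ × ℕ) :=
  [(-1 / 2 + q, 0, 0), (1 / 2 - q, 0, 1), (-1 / 2 + q, 1, 0), (-5 / 2 + 5 * q, 1, 1), (3 / 2 -
    3 * q, 1, 2), (3 / 2 - 3 * q, 1, 3), (-3 * q, 2, 1), (-3 / 2 + 6 * q, 2, 2), (-3 / 2 + 6 *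
    q, 2, 3), (3 - 9 * q, 2, 4)]

/-- Numerator of the `P F₁ G`-coefficient of `(b + Y ∂/∂Y - X ∂/∂X) H`. -/
def hornMixF₁G : List (ℂ × ℕ × ℕ) :=
  [(1, 0, 0), (-1, 0, 1), (3, 1, 0), (3, 1, 1), (-5, 1, 2), (-1, 1, 3), (3, 2, 2), (3, 2, 3),
    (-6, 2, 4)]

/-- Numerator of the `P F G₁`-coefficient of `(b + Y ∂/∂Y - X ∂/∂X) H`. -/
def hornMixFG₁ : List (ℂ × ℕ × ℕ) :=
  [(-1, 0, 0), (1, 0, 1), (-1, 1, 0), (-5, 1, 1), (3, 1, 2), (3, 1, 3), (-6, 2, 1), (3, 2, 2),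
    (3, 2, 3)]

theorem bivariate_hornDenom (p : ℂ × ℂ) : bivariate hornDenom p =
    (1 + p.2) * (1 + p.1 + 8 * p.1 * p.2 + p.1 * p.2 ^ 2 + 9 * p.1 ^ 2 * p.2 ^ 2) := by
  simp [bivariate, hornDenom]
  ring

section EulerBasis

variable {q : ℂ} {P F F₁ G G₁ : ℂ × ℂ → ℂ} {p : ℂ × ℂ}

theorem tendsto_horn : Tendsto (fun p => (hornX p, hornY p)) (𝓝 (0 : ℂ × ℂ)) (𝓝 0) := by
  have h0 : RegularPoint 0 := eventually_regularPoint.self_of_nhds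
  obtain ⟨L, hL, -⟩ := eulerAt_hornX h0
  obtain ⟨M, hM, -⟩ := eulerAt_hornY h0
  simpa [hornX, hornY] using! (hL.prodMk hM).continuousAt.tendsto

/-- `Y ∂H/∂Y` and `(b + Y ∂/∂Y - X ∂/∂X) H` at `(X, Y)`, in terms of `(x, y)`. -/
theorem EulerBasis.first_order (hB : EulerBasis q P F F₁ G G₁ p) (hp : RegularPoint p)
    {H : ℂ × ℂ → ℂ} (hH : DifferentiableAt ℂ H (hornX p, hornY p))
    (hHp : ∀ᶠ p in 𝓝 p, H (hornX p, hornY p) = P p * (F p * G p)) :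
    eulerSnd H (hornX p, hornY p) = P p *
      (bivariate (hornSndFG q) p / bivariate hornDenom p * (F p * G p) +
        bivariate hornSndF₁G p / bivariate hornDenom p * (F₁ p * G p) +
        bivariate hornSndFG₁ p / bivariate hornDenom p * (F p * G₁ p)) ∧
    (q - 1 / 2) * H (hornX p, hornY p) + eulerSnd H (hornX p, hornY p) -
        eulerFst H (hornX p, hornY p) = P p *
      (bivariate (hornMixFG q) p / bivariate hornDenom p * (F p * G p) +
        bivariate hornMixF₁G p / bivariate hornDenom p * (F₁ p * G p) +
        bivariate hornMixFG₁ p / bivariate hornDenom p * (F p * G₁ p)) := by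
  obtain ⟨x, hx⟩ : ∃ x, p.1 = x := ⟨_, rfl⟩
  obtain ⟨y, hy⟩ : ∃ y, p.2 = y := ⟨_, rfl⟩
  obtain ⟨D, hD⟩ : ∃ D, D = (1 + y) * (1 + x + 8 * x * y + x * y ^ 2 + 9 * x ^ 2 * y ^ 2) :=
    ⟨_, rfl⟩
  obtain ⟨gX, hgX⟩ : ∃ gX, gX = 1 + y - 3 * x * y ^ 2 - x * y ^ 3 - 6 * x ^ 2 * y ^ 3 :=
    ⟨_, rfl⟩
  obtain ⟨gY, hgY⟩ : ∃ gY, gY = 2 * y - 6 * x * y + 2 * x * y ^ 3 - 6 * x ^ 2 * y ^ 3 :=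
    ⟨_, rfl⟩
  obtain ⟨aX, haX⟩ : ∃ aX, aX = (1 + x) * gX :=
    ⟨_, rfl⟩
  obtain ⟨aY, haY⟩ : ∃ aY, aY = (1 + x) * gY :=
    ⟨_, rfl⟩
  obtain ⟨bX, hbX⟩ : ∃ bX, bX = -x - 2 * x * y + 2 * x * y ^ 2 + x * y ^ 3 - 2 * x ^ 2 * y ^ 2 +
      2 * x ^ 2 * y ^ 3 + 3 * x ^ 3 * y ^ 3 - 3 * x ^ 3 * y ^ 4 :=
    ⟨_, rfl⟩
  obtain ⟨bY, hbY⟩ : ∃ bY, bY = 1 - y + x + 2 * x * y - 2 * x * y ^ 2 - x * y ^ 3 + 3 * x ^ 2 *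
      y - 2 * x ^ 2 * y ^ 2 + 2 * x ^ 2 * y ^ 3 - 3 * x ^ 2 * y ^ 4 +
      3 * x ^ 3 * y ^ 3 - 3 * x ^ 3 * y ^ 4 :=
    ⟨_, rfl⟩
  obtain ⟨lX, hlX⟩ : ∃ lX, lX = (-1 - q) * x * y + (-3 + 3 * q) * x * y ^ 2 + (-1 + 2 * q) * x *
      y ^ 3 - 6 * q * x ^ 2 * y ^ 2 + (-2 - 2 * q) * x ^ 2 * y ^ 3 - 3
      * q * x ^ 3 * y ^ 3 + (3 - 9 * q) * x ^ 3 * y ^ 4 :=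
    ⟨_, rfl⟩
  obtain ⟨lY, hlY⟩ : ∃ lY, lY = (1 - 2 * q) * y + (1 - 5 * q) * x * y + (3 - 9 * q) * x * y ^ 2
      + (1 - 2 * q) * x * y ^ 3 - 3 * q * x ^ 2 * y + (3 - 9 * q) * x
      ^ 2 * y ^ 2 + (1 - 5 * q) * x ^ 2 * y ^ 3 + (3 - 9 * q) * x ^ 2
      * y ^ 4 - 3 * q * x ^ 3 * y ^ 3 + (3 - 9 * q) * x ^ 3 * y ^ 4 :=
    ⟨_, rfl⟩
  obtain ⟨sX, hsX⟩ : ∃ sX, sX = 1 + y - x - 3 * x * y - 6 * x ^ 2 * y ^ 2 :=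
    ⟨_, rfl⟩
  obtain ⟨sY, hsY⟩ : ∃ sY, sY = 2 + 2 * x - 6 * x * y ^ 2 - 6 * x ^ 2 * y ^ 2 :=
    ⟨_, rfl⟩
  -- H itself has coordinates (1, 0, 0), so only the undifferentiated terms of the general formula
  -- survive.
  obtain ⟨h1, h2⟩ := hB.euler_combination hp (.const 1 p) (.const 0 p) (.const 0 p) hH
    (by simpa using hHp) hx hy hD hgX hgY haX haY hbX hbY hlX hlY hsX hsY
  have h0 := hHp.self_of_nhds
  have hD0 : D ≠ 0 := by
    rw [hD, ← hx, ← hy]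
    exact hp.jac
  have hDp : bivariate hornDenom p = D := by rw [bivariate_hornDenom, hD, hx, hy]
  have eY₀ : bivariate (hornSndFG q) p = lY := by
    rw [hlY]
    simp only [bivariate, List.map_cons, List.map_nil, List.sum_cons, List.sum_nil, hx, hy,
      hornSndFG]
    ring
  have eY₁ : bivariate hornSndF₁G p = sY * (1 + x * y ^ 2) := by
    rw [hsY]
    simp only [bivariate, List.map_cons, List.map_nil, List.sum_cons, List.sum_nil, hx, hy,
      hornSndF₁G]
    ring
  have eY₂ : bivariate hornSndFG₁ p = gY * (1 + x) := by
    rw [hgY]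
    simp only [bivariate, List.map_cons, List.map_nil, List.sum_cons, List.sum_nil, hx, hy,
      hornSndFG₁]
    ring
  have eV₀ : bivariate (hornMixFG q) p = (q - 1 / 2) * D + lY - lX := by
    rw [hD, hlX, hlY]
    simp only [bivariate, List.map_cons, List.map_nil, List.sum_cons, List.sum_nil, hx, hy,
      hornMixFG]
    ring
  have eV₁ : bivariate hornMixF₁G p = (sY - sX) * (1 + x * y ^ 2) := by
    rw [hsX, hsY]
    simp only [bivariate, List.map_cons, List.map_nil, List.sum_cons, List.sum_nil, hx, hy,
      hornMixF₁G]
    ring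
  have eV₂ : bivariate hornMixFG₁ p = (gY - gX) * (1 + x) := by
    rw [hgX, hgY]
    simp only [bivariate, List.map_cons, List.map_nil, List.sum_cons, List.sum_nil, hx, hy,
      hornMixFG₁]
    ring
  have hi : D⁻¹ * D = 1 := inv_mul_cancel₀ hD0
  rw [hDp, eY₀, eY₁, eY₂, eV₀, eV₁, eV₂]
  constructor
  · refine mul_right_cancel₀ hD0 ?_
    linear_combination h2 - P p * (lY * (F p * G p) + sY * (1 + x * y ^ 2) * (F₁ p * G p) +
      gY * (1 + x) * (F p * G₁ p)) * hi
  · refine mul_right_cancel₀ hD0 ?_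
    linear_combination h2 - h1 + (q - 1 / 2) * D * h0 -
      P p * (((q - 1 / 2) * D + lY - lX) * (F p * G p) +
        (sY - sX) * (1 + x * y ^ 2) * (F₁ p * G p) + (gY - gX) * (1 + x) * (F p * G₁ p)) * hi

/-- Differentiating a quotient n / D creates D², and inverting the Jacobian contributes one more D;
multiplication by D³ leaves polynomial coefficients. -/
theorem clear_denominators {Z D P a b l s r t t' c₁ c₂ g Dx Dy n nx ny m mx my k kx ky E₀ E₁ E₂ E₃ : ℂ}
    {r' : ℂ} (hD : D ≠ 0) (h : Z * D = P *
      ((a * ((nx * D - n * Dx) / D ^ 2) + b * ((ny * D - n * Dy) / D ^ 2) + l * (n / D) -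
          c₁ * (m / D) - c₂ * (k / D)) * E₀ +
        (a * ((mx * D - m * Dx) / D ^ 2) + b * ((my * D - m * Dy) / D ^ 2) + l * (m / D) +
          s * (r * (n / D) - t * (m / D))) * E₁ +
        (a * ((kx * D - k * Dx) / D ^ 2) + b * ((ky * D - k * Dy) / D ^ 2) + l * (k / D) +
          g * (r' * (n / D) - t' * (k / D))) * E₂ +
        (a * (m / D) + s * r * (k / D)) * E₃)) :
    Z * D ^ 3 = P *
      ((a * (nx * D - n * Dx) + b * (ny * D - n * Dy) + D * (l * n - c₁ * m - c₂ * k)) * E₀ +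
        (a * (mx * D - m * Dx) + b * (my * D - m * Dy) + D * (l * m + s * (r * n - t * m))) * E₁ +
        (a * (kx * D - k * Dx) + b * (ky * D - k * Dy) + D * (l * k + g * (r' * n - t' * k))) * E₂ +
        D * (a * m + s * r * k) * E₃) := by
  rw [show Z * D ^ 3 = Z * D * D ^ 2 by ring, h]
  field_simp
  ring

/-- The product of Gauss functions satisfies the second Horn equation in `(X, Y)`. -/
theorem EulerBasis.second_order (hB : EulerBasis q P F F₁ G G₁ p) (hp : RegularPoint p)
    {V W : ℂ × ℂ → ℂ} (hV : DifferentiableAt ℂ V (hornX p, hornY p))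
    (hW : DifferentiableAt ℂ W (hornX p, hornY p))
    (hVp : ∀ᶠ p in 𝓝 p, V (hornX p, hornY p) = P p *
      (bivariate (hornSndFG q) p / bivariate hornDenom p * (F p * G p) +
        bivariate hornSndF₁G p / bivariate hornDenom p * (F₁ p * G p) +
        bivariate hornSndFG₁ p / bivariate hornDenom p * (F p * G₁ p)))
    (hWp : ∀ᶠ p in 𝓝 p, W (hornX p, hornY p) = P p *
      (bivariate (hornMixFG q) p / bivariate hornDenom p * (F p * G p) +
        bivariate hornMixF₁G p / bivariate hornDenom p * (F₁ p * G p) +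
        bivariate hornMixFG₁ p / bivariate hornDenom p * (F p * G₁ p))) :
    eulerSnd V (hornX p, hornY p) + (2 * q - 1) * V (hornX p, hornY p) =
      hornY p * (q * W (hornX p, hornY p) + 2 * eulerFst W (hornX p, hornY p) +
        eulerSnd W (hornX p, hornY p)) := by
  obtain ⟨x, hx⟩ : ∃ x, p.1 = x := ⟨_, rfl⟩
  obtain ⟨y, hy⟩ : ∃ y, p.2 = y := ⟨_, rfl⟩
  obtain ⟨D, hD⟩ : ∃ D, D = (1 + y) * (1 + x + 8 * x * y + x * y ^ 2 + 9 * x ^ 2 * y ^ 2) :=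
    ⟨_, rfl⟩
  obtain ⟨gX, hgX⟩ : ∃ gX, gX = 1 + y - 3 * x * y ^ 2 - x * y ^ 3 - 6 * x ^ 2 * y ^ 3 :=
    ⟨_, rfl⟩
  obtain ⟨gY, hgY⟩ : ∃ gY, gY = 2 * y - 6 * x * y + 2 * x * y ^ 3 - 6 * x ^ 2 * y ^ 3 :=
    ⟨_, rfl⟩
  obtain ⟨aX, haX⟩ : ∃ aX, aX = (1 + x) * gX :=
    ⟨_, rfl⟩
  obtain ⟨aY, haY⟩ : ∃ aY, aY = (1 + x) * gY :=
    ⟨_, rfl⟩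
  obtain ⟨bX, hbX⟩ : ∃ bX, bX = -x - 2 * x * y + 2 * x * y ^ 2 + x * y ^ 3 - 2 * x ^ 2 * y ^ 2 +
      2 * x ^ 2 * y ^ 3 + 3 * x ^ 3 * y ^ 3 - 3 * x ^ 3 * y ^ 4 :=
    ⟨_, rfl⟩
  obtain ⟨bY, hbY⟩ : ∃ bY, bY = 1 - y + x + 2 * x * y - 2 * x * y ^ 2 - x * y ^ 3 + 3 * x ^ 2 *
      y - 2 * x ^ 2 * y ^ 2 + 2 * x ^ 2 * y ^ 3 - 3 * x ^ 2 * y ^ 4 +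
      3 * x ^ 3 * y ^ 3 - 3 * x ^ 3 * y ^ 4 :=
    ⟨_, rfl⟩
  obtain ⟨lX, hlX⟩ : ∃ lX, lX = (-1 - q) * x * y + (-3 + 3 * q) * x * y ^ 2 + (-1 + 2 * q) * x *
      y ^ 3 - 6 * q * x ^ 2 * y ^ 2 + (-2 - 2 * q) * x ^ 2 * y ^ 3 - 3
      * q * x ^ 3 * y ^ 3 + (3 - 9 * q) * x ^ 3 * y ^ 4 :=
    ⟨_, rfl⟩
  obtain ⟨lY, hlY⟩ : ∃ lY, lY = (1 - 2 * q) * y + (1 - 5 * q) * x * y + (3 - 9 * q) * x * y ^ 2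
      + (1 - 2 * q) * x * y ^ 3 - 3 * q * x ^ 2 * y + (3 - 9 * q) * x
      ^ 2 * y ^ 2 + (1 - 5 * q) * x ^ 2 * y ^ 3 + (3 - 9 * q) * x ^ 2
      * y ^ 4 - 3 * q * x ^ 3 * y ^ 3 + (3 - 9 * q) * x ^ 3 * y ^ 4 :=
    ⟨_, rfl⟩
  obtain ⟨sX, hsX⟩ : ∃ sX, sX = 1 + y - x - 3 * x * y - 6 * x ^ 2 * y ^ 2 :=
    ⟨_, rfl⟩
  obtain ⟨sY, hsY⟩ : ∃ sY, sY = 2 + 2 * x - 6 * x * y ^ 2 - 6 * x ^ 2 * y ^ 2 :=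
    ⟨_, rfl⟩
  have hD0 : D ≠ 0 := by
    rw [hD, ← hx, ← hy]
    exact hp.jac
  have hDp : bivariate hornDenom p = D := by rw [bivariate_hornDenom, hD, hx, hy]
  have hDp0 : bivariate hornDenom p ≠ 0 := by rwa [hDp]
  have hu := fun l => (eulerAt_bivariate l p).div (eulerAt_bivariate hornDenom p) hDp0
  obtain ⟨-, hVV⟩ := hB.euler_combination hp (hu _) (hu _) (hu _) hV hVp
    hx hy hD hgX hgY haX haY hbX hbY hlX hlY hsX hsY
  obtain ⟨hWX, hWY⟩ := hB.euler_combination hp (hu _) (hu _) (hu _) hW hWp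
    hx hy hD hgX hgY haX haY hbX hbY hlX hlY hsX hsY
  have hV0 := hVp.self_of_nhds
  have hW0 := hWp.self_of_nhds
  clear hVp hWp hu hV hW
  have hd : 1 - 3 * x * y ≠ 0 := by rw [← hx, ← hy]; exact hp.xy
  have he : 1 - y ≠ 0 := by rw [← hy]; exact hp.y
  -- The minus sign comes from replacing 3xy - 1 by 1 - 3xy; it turns the difference of the two
  -- sides of Horn's equation into the sums below.
  have hY : hornY p * ((1 - 3 * x * y) * (1 - y) ^ 2) =
      -(4 * (1 + x * y ^ 2) * (1 + x) * y) := by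
    have hd' : 3 * x * y - 1 ≠ 0 := by rw [← neg_sub]; exact neg_ne_zero.2 hd
    have he' : y - 1 ≠ 0 := by rw [← neg_sub]; exact neg_ne_zero.2 he
    have : hornY p * ((3 * x * y - 1) * (y - 1) ^ 2) = 4 * (x * y ^ 2 + 1) * (x + 1) * y := by
      rw [hornY, hx, hy]
      exact div_mul_cancel₀ _ (mul_ne_zero hd' (pow_ne_zero 2 he'))
    linear_combination -this
  obtain ⟨s₀, hs₀⟩ : ∃ z, bivariate (hornSndFG q) p = z := ⟨_, rfl⟩
  obtain ⟨s₀x, hs₀x⟩ : ∃ z, bivariate (bivariateFst (hornSndFG q)) p = z := ⟨_, rfl⟩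
  obtain ⟨s₀y, hs₀y⟩ : ∃ z, bivariate (bivariateSnd (hornSndFG q)) p = z := ⟨_, rfl⟩
  obtain ⟨s₁, hs₁⟩ : ∃ z, bivariate hornSndF₁G p = z := ⟨_, rfl⟩
  obtain ⟨s₁x, hs₁x⟩ : ∃ z, bivariate (bivariateFst hornSndF₁G) p = z := ⟨_, rfl⟩
  obtain ⟨s₁y, hs₁y⟩ : ∃ z, bivariate (bivariateSnd hornSndF₁G) p = z := ⟨_, rfl⟩
  obtain ⟨s₂, hs₂⟩ : ∃ z, bivariate hornSndFG₁ p = z := ⟨_, rfl⟩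
  obtain ⟨s₂x, hs₂x⟩ : ∃ z, bivariate (bivariateFst hornSndFG₁) p = z := ⟨_, rfl⟩
  obtain ⟨s₂y, hs₂y⟩ : ∃ z, bivariate (bivariateSnd hornSndFG₁) p = z := ⟨_, rfl⟩
  obtain ⟨m₀, hm₀⟩ : ∃ z, bivariate (hornMixFG q) p = z := ⟨_, rfl⟩
  obtain ⟨m₀x, hm₀x⟩ : ∃ z, bivariate (bivariateFst (hornMixFG q)) p = z := ⟨_, rfl⟩
  obtain ⟨m₀y, hm₀y⟩ : ∃ z, bivariate (bivariateSnd (hornMixFG q)) p = z := ⟨_, rfl⟩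
  obtain ⟨m₁, hm₁⟩ : ∃ z, bivariate hornMixF₁G p = z := ⟨_, rfl⟩
  obtain ⟨m₁x, hm₁x⟩ : ∃ z, bivariate (bivariateFst hornMixF₁G) p = z := ⟨_, rfl⟩
  obtain ⟨m₁y, hm₁y⟩ : ∃ z, bivariate (bivariateSnd hornMixF₁G) p = z := ⟨_, rfl⟩
  obtain ⟨m₂, hm₂⟩ : ∃ z, bivariate hornMixFG₁ p = z := ⟨_, rfl⟩
  obtain ⟨m₂x, hm₂x⟩ : ∃ z, bivariate (bivariateFst hornMixFG₁) p = z := ⟨_, rfl⟩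
  obtain ⟨m₂y, hm₂y⟩ : ∃ z, bivariate (bivariateSnd hornMixFG₁) p = z := ⟨_, rfl⟩
  obtain ⟨Dx, hDx⟩ : ∃ z, bivariate (bivariateFst hornDenom) p = z := ⟨_, rfl⟩
  obtain ⟨Dy, hDy⟩ : ∃ z, bivariate (bivariateSnd hornDenom) p = z := ⟨_, rfl⟩
  simp only [hs₀, hs₀x, hs₀y, hs₁, hs₁x, hs₁y, hs₂, hs₂x, hs₂y, hm₀, hm₀x, hm₀y, hm₁, hm₁x, hm₁y, hm₂, hm₂x, hm₂y, hDx, hDy, hDp] at hVV hWX hWY hV0 hW0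
  replace hVV := clear_denominators hD0 hVV
  replace hWX := clear_denominators hD0 hWX
  replace hWY := clear_denominators hD0 hWY
  have hV1 : V (hornX p, hornY p) * D =
      P p * (s₀ * (F p * G p) + s₁ * (F₁ p * G p) + s₂ * (F p * G₁ p)) := by
    rw [hV0]
    field_simp
  have hW1 : W (hornX p, hornY p) * D =
      P p * (m₀ * (F p * G p) + m₁ * (F₁ p * G p) + m₂ * (F p * G₁ p)) := by
    rw [hW0]
    field_simp
  simp only [bivariate, bivariateFst, bivariateSnd, hornSndFG, hornSndF₁G, hornSndFG₁, hornMixFG,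
    hornMixF₁G, hornMixFG₁, hornDenom, List.map_cons, List.map_nil, List.sum_cons, List.sum_nil,
    hx, hy, Nat.cast_ofNat, Nat.cast_one, Nat.cast_zero]
    at hs₀ hs₀x hs₀y hs₁ hs₁x hs₁y hs₂ hs₂x hs₂y hm₀ hm₀x hm₀y hm₁ hm₁x hm₁y hm₂ hm₂x hm₂y hDx hDy
  -- `key₀`, `key₁`, `key₂` and `key₃` are the coordinates of Horn's equation along PFG, PF₁G, PFG₁
  -- and PF₁G₁, multiplied by the denominators of Y and by the powers of D in the coefficients.
  have key₀ : (1 - 3 * x * y) * (1 - y) ^ 2 * (aY * (s₀x * D - s₀ * Dx) + bY * (s₀y * D - s₀ * Dy) +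
        D * (lY * s₀ - sY * (x * y ^ 2) * ((3 / 2 * q - 1 / 2) * (3 / 2 * q)) * s₁ -
          gY * x * (1 / 2 * q * (1 / 2 * q + 1 / 2)) * s₂) + (2 * q - 1) * D ^ 2 * s₀) +
      4 * (1 + x * y ^ 2) * (1 + x) * y * (q * D ^ 2 * m₀ +
        2 * (aX * (m₀x * D - m₀ * Dx) + bX * (m₀y * D - m₀ * Dy) +
        D * (lX * m₀ - sX * (x * y ^ 2) * ((3 / 2 * q - 1 / 2) * (3 / 2 * q)) * m₁ -
          gX * x * (1 / 2 * q * (1 / 2 * q + 1 / 2)) * m₂)) +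
        (aY * (m₀x * D - m₀ * Dx) + bY * (m₀y * D - m₀ * Dy) +
        D * (lY * m₀ - sY * (x * y ^ 2) * ((3 / 2 * q - 1 / 2) * (3 / 2 * q)) * m₁ -
          gY * x * (1 / 2 * q * (1 / 2 * q + 1 / 2)) * m₂))) = 0 := by
    clear hVV hWX hWY hV0 hW0 hV1 hW1 hY hDp hDp0
    subst_vars
    ring
  have key₁ : (1 - 3 * x * y) * (1 - y) ^ 2 * (aY * (s₁x * D - s₁ * Dx) + bY * (s₁y * D - s₁ * Dy) +
        D * (lY * s₁ + sY * ((1 + x * y ^ 2) * s₀ -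
          (x * y ^ 2 * (3 * q - 1 / 2) + (q - 1 / 2)) * s₁)) + (2 * q - 1) * D ^ 2 * s₁) +
      4 * (1 + x * y ^ 2) * (1 + x) * y * (q * D ^ 2 * m₁ +
        2 * (aX * (m₁x * D - m₁ * Dx) + bX * (m₁y * D - m₁ * Dy) +
        D * (lX * m₁ + sX * ((1 + x * y ^ 2) * m₀ -
          (x * y ^ 2 * (3 * q - 1 / 2) + (q - 1 / 2)) * m₁))) +
        (aY * (m₁x * D - m₁ * Dx) + bY * (m₁y * D - m₁ * Dy) +
        D * (lY * m₁ + sY * ((1 + x * y ^ 2) * m₀ -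
          (x * y ^ 2 * (3 * q - 1 / 2) + (q - 1 / 2)) * m₁)))) = 0 := by
    clear hVV hWX hWY hV0 hW0 hV1 hW1 hY hDp hDp0
    subst_vars
    ring
  have key₂ : (1 - 3 * x * y) * (1 - y) ^ 2 * (aY * (s₂x * D - s₂ * Dx) + bY * (s₂y * D - s₂ * Dy) +
        D * (lY * s₂ + gY * ((1 + x) * s₀ -
          (x * (q + 1 / 2) + (1 / 2 - q)) * s₂)) + (2 * q - 1) * D ^ 2 * s₂) +
      4 * (1 + x * y ^ 2) * (1 + x) * y * (q * D ^ 2 * m₂ +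
        2 * (aX * (m₂x * D - m₂ * Dx) + bX * (m₂y * D - m₂ * Dy) +
        D * (lX * m₂ + gX * ((1 + x) * m₀ -
          (x * (q + 1 / 2) + (1 / 2 - q)) * m₂))) +
        (aY * (m₂x * D - m₂ * Dx) + bY * (m₂y * D - m₂ * Dy) +
        D * (lY * m₂ + gY * ((1 + x) * m₀ -
          (x * (q + 1 / 2) + (1 / 2 - q)) * m₂)))) = 0 := by
    clear hVV hWX hWY hV0 hW0 hV1 hW1 hY hDp hDp0
    subst_vars
    ring
  have key₃ : (1 - 3 * x * y) * (1 - y) ^ 2 * (D * (aY * s₁ + sY * (1 + x * y ^ 2) * s₂)) +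
      4 * (1 + x * y ^ 2) * (1 + x) * y * (2 * (D * (aX * m₁ + sX * (1 + x * y ^ 2) * m₂)) +
        (D * (aY * m₁ + sY * (1 + x * y ^ 2) * m₂))) = 0 := by
    clear hVV hWX hWY hV0 hW0 hV1 hW1 hY hDp hDp0
    subst_vars
    ring
  refine mul_right_cancel₀ (mul_ne_zero (pow_ne_zero 3 hD0)
    (mul_ne_zero hd (pow_ne_zero 2 he))) ?_
  linear_combination ((1 - 3 * x * y) * (1 - y) ^ 2) * hVV +
    (2 * q - 1) * ((1 - 3 * x * y) * (1 - y) ^ 2) * D ^ 2 * hV1 +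
    4 * (1 + x * y ^ 2) * (1 + x) * y * (q * D ^ 2 * hW1 + 2 * hWX + hWY) -
    (q * W (hornX p, hornY p) + 2 * eulerFst W (hornX p, hornY p) +
        eulerSnd W (hornX p, hornY p)) * D ^ 3 * hY +
    P p * (F p * G p) * key₀ + P p * (F₁ p * G p) * key₁ + P p * (F p * G₁ p) * key₂ +
    P p * (F₁ p * G₁ p) * key₃

end EulerBasis

/-! ### Shifted factorials and the coefficients of H₅ -/

theorem shiftedFactorial_add_one {a : ℂ} {z : ℤ} (h : z < 0 → a + z ≠ 0) :
    shiftedFactorial a (z + 1) = shiftedFactorial a z * (a + z) := by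
  rcases z with n | n
  · have : Int.ofNat n + 1 = Int.ofNat (n + 1) := rfl
    rw [this]
    simp only [shiftedFactorial, Finset.prod_range_succ]
    simp
  · have h0 := h (Int.negSucc_lt_zero n)
    have hz : a + ((Int.negSucc n : ℤ) : ℂ) = a - ((n : ℂ) + 1) := by
      rw [Int.cast_negSucc]
      push_cast
      ring
    rw [hz] at h0 ⊢
    rcases n with _ | n
    · have : Int.negSucc 0 + 1 = Int.ofNat 0 := rfl
      rw [this]
      simp only [shiftedFactorial, Finset.prod_range_succ, Finset.prod_range_zero, one_mul]
      exact (inv_mul_cancel₀ h0).symm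
    · have : Int.negSucc (n + 1) + 1 = Int.negSucc n := rfl
      rw [this]
      simp only [shiftedFactorial]
      rw [Finset.prod_range_succ _ (n + 1), mul_inv, mul_assoc, inv_mul_cancel₀ h0, mul_one]

theorem shiftedFactorial_zero (a : ℂ) : shiftedFactorial a 0 = 1 :=
  Finset.prod_range_zero _

theorem shiftedFactorial_natCast_ne_zero {a : ℂ} (h : ∀ k : ℕ, a ≠ -(k : ℂ)) (n : ℕ) :
    shiftedFactorial a n ≠ 0 := by
  refine Finset.prod_ne_zero_iff.2 fun j _ hj => h j (eq_neg_of_add_eq_zero_left hj)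

/-- The coefficients of Horn's series `H₅`. -/
noncomputable def hornH5Coefficient (a b c : ℂ) (k : ℕ × ℕ) : ℂ :=
  shiftedFactorial a (2 * (k.1 : ℤ) + (k.2 : ℤ)) * shiftedFactorial b ((k.2 : ℤ) - (k.1 : ℤ)) /
    (shiftedFactorial c (k.2 : ℤ) * (k.1.factorial : ℂ) * (k.2.factorial : ℂ))

section Coefficients

variable {q : ℂ}

theorem hornH5Coefficient_succ_snd {a b c : ℂ} (hc : ∀ k : ℕ, c ≠ -(k : ℂ))
    (hb : ∀ k : ℕ, b ≠ (k : ℂ) + 1) (m n : ℕ) :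
    hornH5Coefficient a b c (m, n + 1) * ((n + 1) * (c + n)) =
      hornH5Coefficient a b c (m, n) * ((a + 2 * m + n) * (b + n - m)) := by
  have h1 : shiftedFactorial a (2 * (m : ℤ) + ((n + 1 : ℕ) : ℤ)) =
      shiftedFactorial a (2 * (m : ℤ) + n) * (a + 2 * m + n) := by
    have := shiftedFactorial_add_one (a := a) (z := 2 * (m : ℤ) + n) (fun h => by omega)
    push_cast at this ⊢
    rw [← add_assoc, this, add_assoc]
  have h2 : shiftedFactorial b (((n + 1 : ℕ) : ℤ) - m) =
      shiftedFactorial b ((n : ℤ) - m) * (b + n - m) := by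
    -- For n < m the step could only fail at b = m - n, a positive integer, which `hb` excludes.
    have := shiftedFactorial_add_one (a := b) (z := (n : ℤ) - m) (fun h h0 => by
      obtain ⟨k, hk⟩ : ∃ k : ℕ, (m : ℤ) - n = k + 1 := ⟨m - n - 1, by omega⟩
      refine hb k ?_
      have hk' : (m : ℂ) - n = k + 1 := by exact_mod_cast congrArg (Int.cast : ℤ → ℂ) hk
      push_cast at h0
      linear_combination h0 + hk')
    have e : ((n + 1 : ℕ) : ℤ) - m = (n : ℤ) - m + 1 := by push_cast; ring
    rw [e, this]
    push_cast
    ring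
  have h3 : shiftedFactorial c ((n + 1 : ℕ) : ℤ) = shiftedFactorial c (n : ℤ) * (c + n) := by
    have := shiftedFactorial_add_one (a := c) (z := (n : ℤ)) (fun h => by omega)
    push_cast at this ⊢
    exact this
  have h4 := shiftedFactorial_natCast_ne_zero hc n
  have h5 : c + n ≠ 0 := fun h => hc n (eq_neg_of_add_eq_zero_left h)
  have h6 : (n : ℂ) + 1 ≠ 0 := Nat.cast_add_one_ne_zero n
  have h7 : (n.factorial : ℂ) ≠ 0 := by exact_mod_cast n.factorial_ne_zero
  have h8 : (m.factorial : ℂ) ≠ 0 := by exact_mod_cast m.factorial_ne_zero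
  simp only [hornH5Coefficient]
  rw [h1, h2, h3, Nat.factorial_succ, Nat.cast_mul, Nat.cast_succ]
  field_simp

/-- This combines the duplication (q)_{2m} = 4^m (q/2)_m (q/2 + 1/2)_m with the reflection (q -
1/2)_{-m} = (-1)^m / (3/2 - q)_m. The parameter c is arbitrary because (c)_0 = 1. -/
theorem hornH5Coefficient_zero_snd (hb : ∀ k : ℕ, q - 1 / 2 ≠ (k : ℂ) + 1) (c : ℂ) (m : ℕ) :
    hornH5Coefficient q (q - 1 / 2) c (m, 0) =
      ordinaryHypergeometricCoefficient (1 / 2 * q) (1 / 2 * q + 1 / 2) (3 / 2 - q) m *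
        (-4) ^ m := by
  induction m with
  | zero => simp [hornH5Coefficient, ordinaryHypergeometricCoefficient, shiftedFactorial_zero]
  | succ m ih =>
    have hc' : ∀ k : ℕ, 3 / 2 - q ≠ -(k : ℂ) := fun k hk => hb k (by linear_combination -hk)
    have hr := ordinaryHypergeometricCoefficient_succ (a := 1 / 2 * q) (b := 1 / 2 * q + 1 / 2) hc' m
    have h1 : shiftedFactorial q (2 * ((m + 1 : ℕ) : ℤ) + ((0 : ℕ) : ℤ)) =
        shiftedFactorial q (2 * (m : ℤ) + ((0 : ℕ) : ℤ)) * (q + 2 * m) * (q + 2 * m + 1) := by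
      have e1 := shiftedFactorial_add_one (a := q) (z := 2 * (m : ℤ)) (fun h => by omega)
      have e2 := shiftedFactorial_add_one (a := q) (z := 2 * (m : ℤ) + 1) (fun h => by omega)
      push_cast at e1 e2 ⊢
      rw [add_zero, add_zero, show 2 * ((m : ℤ) + 1) = 2 * m + 1 + 1 by ring, e2, e1]
      ring
    have h5 : q - 1 / 2 - (m + 1) ≠ 0 := fun h => hb m (by linear_combination h)
    have h2 : shiftedFactorial (q - 1 / 2) (((0 : ℕ) : ℤ) - m) =
        shiftedFactorial (q - 1 / 2) (((0 : ℕ) : ℤ) - ((m + 1 : ℕ) : ℤ)) * (q - 1 / 2 - (m + 1)) := by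
      have := shiftedFactorial_add_one (a := q - 1 / 2) (z := ((0 : ℕ) : ℤ) - ((m + 1 : ℕ) : ℤ))
        (fun _ h0 => h5 (by push_cast at h0; linear_combination h0))
      rw [show ((0 : ℕ) : ℤ) - m = ((0 : ℕ) : ℤ) - ((m + 1 : ℕ) : ℤ) + 1 by push_cast; ring, this]
      push_cast
      ring
    have h6 : (m : ℂ) + 1 ≠ 0 := Nat.cast_add_one_ne_zero m
    have h8 : (m.factorial : ℂ) ≠ 0 := by exact_mod_cast m.factorial_ne_zero
    have step : hornH5Coefficient q (q - 1 / 2) c (m + 1, 0) * ((m + 1) * (q - 1 / 2 - (m + 1))) =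
        hornH5Coefficient q (q - 1 / 2) c (m, 0) * ((q + 2 * m) * (q + 2 * m + 1)) := by
      simp only [hornH5Coefficient]
      rw [h1, h2, Nat.factorial_succ, Nat.cast_mul, Nat.cast_succ, Nat.factorial_zero,
        Nat.cast_one, Nat.cast_zero, shiftedFactorial_zero]
      generalize shiftedFactorial (q - 1 / 2) _ = S
      generalize q - 1 / 2 - ((m : ℂ) + 1) = t at h5 ⊢
      field_simp
      push_cast
      ring
    refine mul_right_cancel₀ (mul_ne_zero h6 h5) ?_
    rw [step, ih, pow_succ]
    linear_combination -4 * (-4) ^ m * hr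

/-- Induction on n for each m: since (n + 1)(2q + n) ≠ 0, the recursion in n alone propagates the
values at n = 0, and no recursion in m is required. -/
theorem coefficients_eq_hornH5 {c : ℕ × ℕ → ℂ} (hc : ∀ k : ℕ, 2 * q ≠ -(k : ℂ))
    (hb : ∀ k : ℕ, q - 1 / 2 ≠ (k : ℂ) + 1)
    (h0 : ∀ m, c (m, 0) = ordinaryHypergeometricCoefficient (1 / 2 * q) (1 / 2 * q + 1 / 2)
      (3 / 2 - q) m * (-4) ^ m)
    (hrec : ∀ m n : ℕ, c (m, n + 1) * ((n + 1) * (2 * q + n)) =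
      c (m, n) * ((q + 2 * m + n) * (q - 1 / 2 + n - m))) :
    c = hornH5Coefficient q (q - 1 / 2) (2 * q) := by
  ext ⟨m, n⟩
  induction n with
  | zero => rw [h0, hornH5Coefficient_zero_snd hb]
  | succ n ih =>
    have h5 : 2 * q + n ≠ 0 := fun h => hc n (eq_neg_of_add_eq_zero_left h)
    have h6 : (n : ℂ) + 1 ≠ 0 := Nat.cast_add_one_ne_zero n
    refine mul_right_cancel₀ (mul_ne_zero h6 h5) ?_
    rw [hrec, hornH5Coefficient_succ_snd hc hb, ih]

end Coefficients

/-! ### From Horn's equation to coefficients; local inverse of the substitution -/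

/-- Horn's second equation `ϑ_Y(ϑ_Y + c - 1)H = Y(a + 2ϑ_X + ϑ_Y)(b + ϑ_Y - ϑ_X)H`
as a recursion for the coefficients. -/
theorem horn_recursion {H : ℂ × ℂ → ℂ} {d : ℕ × ℕ → ℂ} {a b c : ℂ}
    (hH : IsDoubleSeries H d)
    (heq : ∀ᶠ s : ℂ × ℂ in 𝓝 0, eulerSnd (eulerSnd H) s + (c - 1) * eulerSnd H s =
      s.2 * (a * (b * H s + eulerSnd H s - eulerFst H s) +
        2 * eulerFst (fun s => b * H s + eulerSnd H s - eulerFst H s) s +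
        eulerSnd (fun s => b * H s + eulerSnd H s - eulerFst H s) s)) (m n : ℕ) :
    d (m, n + 1) * ((n + 1) * (c + n)) = d (m, n) * ((a + 2 * m + n) * (b + n - m)) := by
  have hW := ((hH.const_mul b).add hH.eulerSnd).sub hH.eulerFst
  have h1 := hH.eulerSnd.eulerSnd.add (hH.eulerSnd.const_mul (c - 1))
  have h2 := (((hW.const_mul a).add (hW.eulerFst.const_mul 2)).add hW.eulerSnd).mul_snd
  have := congrFun ((h1.congr_left heq).unique h2) (m, n + 1)
  simp only [Nat.add_eq_zero_iff, one_ne_zero, and_false, if_false, Nat.add_sub_cancel,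
    Nat.cast_add, Nat.cast_one] at this
  linear_combination this

/-- The substitution `(x, y) ↦ (X, Y)`. -/
noncomputable def hornMap (p : ℂ × ℂ) : ℂ × ℂ := (hornX p, hornY p)

theorem hornMap_zero : hornMap 0 = 0 := by simp [hornMap, hornX, hornY]

theorem analyticAt_hornMap : AnalyticAt ℂ hornMap 0 := by
  have hx : AnalyticAt ℂ (fun p : ℂ × ℂ => p.1) 0 := analyticAt_fst
  have hy : AnalyticAt ℂ (fun p : ℂ × ℂ => p.2) 0 := analyticAt_snd
  unfold hornMap hornX hornY
  refine AnalyticAt.prod ?_ ?_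
  · refine AnalyticAt.div (by fun_prop) (by fun_prop) (by simp)
  · refine AnalyticAt.div (by fun_prop) (by fun_prop) (by simp)

/-- The derivative of the substitution at the origin. -/
noncomputable def hornMapDeriv : (ℂ × ℂ) ≃L[ℂ] ℂ × ℂ :=
  (ContinuousLinearEquiv.unitsEquivAut ℂ (Units.mk0 (1 / 4 : ℂ) (by norm_num))).prodCongr
    (ContinuousLinearEquiv.unitsEquivAut ℂ (Units.mk0 (-4 : ℂ) (by norm_num)))

theorem hasFDerivAt_hornMap :
    HasFDerivAt hornMap (hornMapDeriv : ℂ × ℂ →L[ℂ] ℂ × ℂ) 0 := by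
  have hx : AnalyticAt ℂ (fun p : ℂ × ℂ => p.1) 0 := analyticAt_fst
  have hy : AnalyticAt ℂ (fun p : ℂ × ℂ => p.2) 0 := analyticAt_snd
  have hu : DifferentiableAt ℂ
      (fun p : ℂ × ℂ => (p.2 - 1) ^ 2 / (4 * (3 * p.1 * p.2 - 1) ^ 2)) 0 := by
    refine AnalyticAt.differentiableAt (AnalyticAt.div ?_ ?_ ?_)
    · fun_prop
    · fun_prop
    · simp
  have hv : DifferentiableAt ℂ (fun p : ℂ × ℂ =>
      4 * (p.1 * p.2 ^ 2 + 1) * (p.1 + 1) / ((3 * p.1 * p.2 - 1) * (p.2 - 1) ^ 2)) 0 := by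
    refine AnalyticAt.differentiableAt (AnalyticAt.div ?_ ?_ ?_)
    · fun_prop
    · fun_prop
    · simp
  -- With X = x u and Y = y v, the product rule at the origin leaves only u(0) = 1/4 and v(0) = -4.
  have h1 := (hasFDerivAt_fst (𝕜 := ℂ) (p := (0 : ℂ × ℂ))).mul hu.hasFDerivAt
  have h2 := (hasFDerivAt_snd (𝕜 := ℂ) (p := (0 : ℂ × ℂ))).mul hv.hasFDerivAt
  convert! h1.prodMk h2 using 1
  · funext p
    simp only [hornMap, hornX, hornY, Pi.mul_apply]
    ring_nf
  · ext <;> norm_num [hornMapDeriv]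

/-- The substitution has an analytic inverse near the origin. -/
theorem exists_hornMap_inverse : ∃ ψ : ℂ × ℂ → ℂ × ℂ, AnalyticAt ℂ ψ 0 ∧ ψ 0 = 0 ∧
    (∀ᶠ p in 𝓝 0, ψ (hornMap p) = p) ∧ ∀ᶠ s in 𝓝 0, hornMap (ψ s) = s := by
  have h0 : HasStrictFDerivAt hornMap (hornMapDeriv : ℂ × ℂ →L[ℂ] ℂ × ℂ) 0 := by
    rw [← hasFDerivAt_hornMap.fderiv]
    exact analyticAt_hornMap.hasStrictFDerivAt
  set e := h0.toOpenPartialHomeomorph hornMap with he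
  have hcoe : ∀ p, e p = hornMap p := fun p => rfl
  have hmem : (0 : ℂ × ℂ) ∈ e.source := h0.mem_toOpenPartialHomeomorph_source
  have hz : e 0 = 0 := hornMap_zero
  have hzt : (0 : ℂ × ℂ) ∈ e.target := by simpa only [hz] using e.map_source hmem
  refine ⟨e.symm, ?_, ?_, ?_, ?_⟩
  · have := e.analyticAt_symm' (i := hornMapDeriv) hmem analyticAt_hornMap
      hasFDerivAt_hornMap.fderiv
    rwa [hz] at this
  · have := e.left_inv hmem
    rwa [hz] at this
  · filter_upwards [e.open_source.mem_nhds hmem] with p hp using e.left_inv hp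
  · filter_upwards [e.open_target.mem_nhds hzt] with s hs using e.right_inv hs

theorem EulerAt.of_eq {F : ℂ × ℂ → ℂ} {p : ℂ × ℂ} {A B A' B' : ℂ} (h : EulerAt F p A B)
    (hA : A = A') (hB : B = B') : EulerAt F p A' B' := by
  rwa [← hA, ← hB]

/-! ### The Gauss product and its expansion in (X, Y) -/

/-- The product of two Gauss functions, with its algebraic prefactor. -/
noncomputable def gaussProduct (q : ℂ) (p : ℂ × ℂ) : ℂ :=
  (1 - 3 * p.1 * p.2) ^ q * (1 - p.2) ^ (2 * q - 1) *
    (ordinaryHypergeometric (3 / 2 * q - 1 / 2) (3 / 2 * q) (q + 1 / 2) (-(p.1 * p.2 ^ 2)) *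
      ordinaryHypergeometric (1 / 2 * q) (1 / 2 * q + 1 / 2) (3 / 2 - q) (-p.1))

theorem one_sub_mem_slitPlane : ∀ᶠ p : ℂ × ℂ in 𝓝 0,
    1 - 3 * p.1 * p.2 ∈ Complex.slitPlane ∧ 1 - p.2 ∈ Complex.slitPlane := by
  have h1 : ContinuousAt (fun p : ℂ × ℂ => 1 - 3 * p.1 * p.2) 0 := by fun_prop
  have h2 : ContinuousAt (fun p : ℂ × ℂ => 1 - p.2) 0 := by fun_prop
  exact (h1.eventually_mem (Complex.isOpen_slitPlane.mem_nhds (by simp))).and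
    (h2.eventually_mem (Complex.isOpen_slitPlane.mem_nhds (by simp)))

section

variable {q : ℂ}

theorem analyticAt_gaussProduct (hc : ∀ k : ℕ, q + 1 / 2 ≠ -(k : ℂ))
    (hc' : ∀ k : ℕ, 3 / 2 - q ≠ -(k : ℂ)) : AnalyticAt ℂ (gaussProduct q) 0 := by
  have hx : AnalyticAt ℂ (fun p : ℂ × ℂ => p.1) 0 := analyticAt_fst
  have hy : AnalyticAt ℂ (fun p : ℂ × ℂ => p.2) 0 := analyticAt_snd
  obtain ⟨h1, h2⟩ := one_sub_mem_slitPlane.self_of_nhds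
  have hf := analyticAt_hypergeometric (a := 3 / 2 * q - 1 / 2) (b := 3 / 2 * q) hc
  have hg := analyticAt_hypergeometric (a := 1 / 2 * q) (b := 1 / 2 * q + 1 / 2) hc'
  have hF : AnalyticAt ℂ (fun p : ℂ × ℂ => ordinaryHypergeometric (3 / 2 * q - 1 / 2) (3 / 2 * q)
      (q + 1 / 2) (-(p.1 * p.2 ^ 2))) 0 :=
    hf.comp_of_eq (f := fun p : ℂ × ℂ => -(p.1 * p.2 ^ 2)) (by fun_prop) (by simp)
  have hG : AnalyticAt ℂ (fun p : ℂ × ℂ => ordinaryHypergeometric (1 / 2 * q) (1 / 2 * q + 1 / 2)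
      (3 / 2 - q) (-p.1)) 0 :=
    hg.comp_of_eq (f := fun p : ℂ × ℂ => -p.1) (by fun_prop) (by simp)
  have hP1 : AnalyticAt ℂ (fun p : ℂ × ℂ => (1 - 3 * p.1 * p.2) ^ q) 0 :=
    AnalyticAt.cpow (by fun_prop) analyticAt_const h1
  have hP2 : AnalyticAt ℂ (fun p : ℂ × ℂ => (1 - p.2) ^ (2 * q - 1)) 0 :=
    AnalyticAt.cpow (by fun_prop) analyticAt_const h2
  exact (hP1.mul hP2).mul (hF.mul hG)

theorem eulerAt_prefactor {p : ℂ × ℂ} (h1 : 1 - 3 * p.1 * p.2 ∈ Complex.slitPlane)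
    (h2 : 1 - p.2 ∈ Complex.slitPlane) :
    EulerAt (fun p => (1 - 3 * p.1 * p.2) ^ q * (1 - p.2) ^ (2 * q - 1)) p
      ((1 - 3 * p.1 * p.2) ^ q * (1 - p.2) ^ (2 * q - 1) *
        (-(3 * q * p.1 * p.2) / (1 - 3 * p.1 * p.2)))
      ((1 - 3 * p.1 * p.2) ^ q * (1 - p.2) ^ (2 * q - 1) *
        (-(3 * q * p.1 * p.2) / (1 - 3 * p.1 * p.2) - (2 * q - 1) * p.2 / (1 - p.2))) := by
  have e1 := (EulerAt.const 1 p).sub (((EulerAt.fst p).const_mul 3).mul (.snd p))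
  have e2 := (EulerAt.const 1 p).sub (.snd p)
  have d1 := e1.scomp ((hasDerivAt_id _).cpow_const (c := q) h1)
  have d2 := e2.scomp ((hasDerivAt_id _).cpow_const (c := 2 * q - 1) h2)
  have n1 := Complex.slitPlane_ne_zero h1
  have n2 := Complex.slitPlane_ne_zero h2
  refine (d1.mul d2).of_eq ?_ ?_
  · simp only [id, Complex.cpow_sub _ _ n1, Complex.cpow_one]
    ring
  · simp only [id, Complex.cpow_sub _ 1 n1, Complex.cpow_sub (2 * q) 1 n2,
      Complex.cpow_sub (2 * q - 1) 1 n2, Complex.cpow_one]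
    ring

theorem exists_eulerBasis (hc : ∀ k : ℕ, q + 1 / 2 ≠ -(k : ℂ))
    (hc' : ∀ k : ℕ, 3 / 2 - q ≠ -(k : ℂ)) : ∃ F₁ G₁ : ℂ × ℂ → ℂ, ∀ᶠ p in 𝓝 0,
      EulerBasis q (fun p => (1 - 3 * p.1 * p.2) ^ q * (1 - p.2) ^ (2 * q - 1))
        (fun p => ordinaryHypergeometric (3 / 2 * q - 1 / 2) (3 / 2 * q) (q + 1 / 2)
          (-(p.1 * p.2 ^ 2))) F₁
        (fun p => ordinaryHypergeometric (1 / 2 * q) (1 / 2 * q + 1 / 2) (3 / 2 - q) (-p.1))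
        G₁ p := by
  obtain ⟨f₁, hf⟩ := exists_euler_hypergeometric (3 / 2 * q - 1 / 2) (3 / 2 * q) hc
  obtain ⟨g₁, hg⟩ := exists_euler_hypergeometric (1 / 2 * q) (1 / 2 * q + 1 / 2) hc'
  refine ⟨fun p => f₁ (-(p.1 * p.2 ^ 2)), fun p => g₁ (-p.1), ?_⟩
  have t1 : Tendsto (fun p : ℂ × ℂ => -(p.1 * p.2 ^ 2)) (𝓝 0) (𝓝 0) := by
    have : Continuous (fun p : ℂ × ℂ => -(p.1 * p.2 ^ 2)) := by fun_prop
    simpa using this.tendsto 0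
  have t2 : Tendsto (fun p : ℂ × ℂ => -p.1) (𝓝 0) (𝓝 0) := by
    have : Continuous (fun p : ℂ × ℂ => -p.1) := by fun_prop
    simpa using this.tendsto 0
  filter_upwards [one_sub_mem_slitPlane, t1.eventually hf, t2.eventually hg]
    with p ⟨h1, h2⟩ ⟨⟨d, hd, hd'⟩, e, he, he'⟩ ⟨⟨s, hs, hs'⟩, t, ht, ht'⟩
  -- The arguments -xy² and -x are eigenvectors of the Euler derivatives, with weights (1, 2) and
  -- (1, 0), so ϑf and ϑg pull back to F₁ and G₁ with these weights.
  have z1 : EulerAt (fun p => -(p.1 * p.2 ^ 2)) p (-(p.1 * p.2 ^ 2)) (2 * -(p.1 * p.2 ^ 2)) := by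
    have := ((EulerAt.fst p).mul ((EulerAt.snd p).pow 2)).const_mul (-1)
    simp only [neg_one_mul] at this
    refine this.of_eq ?_ ?_ <;> push_cast <;> ring
  have z2 : EulerAt (fun p => -p.1) p (-p.1) 0 := by
    have := (EulerAt.fst p).const_mul (-1)
    simp only [neg_one_mul] at this
    exact this.of_eq rfl (by ring)
  refine ⟨eulerAt_prefactor h1 h2, ?_, ⟨-(p.1 * p.2 ^ 2) * e, ?_, ?_⟩, ?_, ⟨-p.1 * t, ?_, ?_⟩⟩
  · exact (z1.scomp hd).of_eq (by rw [← hd']; ring) (by rw [← hd']; ring)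
  · exact (z1.scomp he).of_eq (by ring) (by ring)
  · linear_combination he'
  · exact (z2.scomp hs).of_eq (by rw [← hs']; ring) (by ring)
  · exact (z2.scomp ht).of_eq (by ring) (by ring)
  · linear_combination ht'

/-- In the coordinates `(X, Y)`, the product satisfies the second Horn equation. -/
theorem horn_equation {P F F₁ G G₁ H : ℂ × ℂ → ℂ}
    (hB : ∀ᶠ p in 𝓝 0, EulerBasis q P F F₁ G G₁ p) (hH : AnalyticAt ℂ H 0)
    (hHp : ∀ᶠ p in 𝓝 0, H (hornX p, hornY p) = P p * (F p * G p)) :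
    ∀ᶠ p in 𝓝 0, eulerSnd (eulerSnd H) (hornX p, hornY p) +
        (2 * q - 1) * eulerSnd H (hornX p, hornY p) =
      hornY p * (q * ((q - 1 / 2) * H (hornX p, hornY p) + eulerSnd H (hornX p, hornY p) -
          eulerFst H (hornX p, hornY p)) +
        2 * eulerFst (fun s => (q - 1 / 2) * H s + eulerSnd H s - eulerFst H s)
          (hornX p, hornY p) +
        eulerSnd (fun s => (q - 1 / 2) * H s + eulerSnd H s - eulerFst H s)
          (hornX p, hornY p)) := by
  have hV := hH.eulerSnd
  have hW : AnalyticAt ℂ (fun s => (q - 1 / 2) * H s + eulerSnd H s - eulerFst H s) 0 :=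
    ((analyticAt_const.mul hH).add hV).sub hH.eulerFst
  -- The first-order formulas have to hold on a neighbourhood of each point, since they are
  -- differentiated once more.
  have first := (hB.and (eventually_regularPoint.and (hHp.eventually_nhds.and
    (tendsto_horn.eventually hH.eventually_analyticAt)))).mono fun p h =>
      h.1.first_order h.2.1 h.2.2.2.differentiableAt h.2.2.1
  filter_upwards [hB, eventually_regularPoint, first.eventually_nhds,
    tendsto_horn.eventually hV.eventually_analyticAt,
    tendsto_horn.eventually hW.eventually_analyticAt] with p h1 h2 h3 h4 h5
  exact h1.second_order (W := fun s => (q - 1 / 2) * H s + eulerSnd H s - eulerFst H s) h2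
    h4.differentiableAt h5.differentiableAt (h3.mono fun _ h => h.1) (h3.mono fun _ h => h.2)

theorem hornMap_four_mul (X : ℂ) : hornMap (4 * X, 0) = (X, 0) := by
  simp [hornMap, hornX, hornY]

/-- `H₅` is the product of Gauss functions in the coordinates `(X, Y)`. -/
theorem isDoubleSeries_of_comp_hornMap (hq : ∀ k : ℕ, 2 * q ≠ -(k : ℂ))
    (hb : ∀ k : ℕ, q - 1 / 2 ≠ (k : ℂ) + 1) : ∃ H : ℂ × ℂ → ℂ,
      (∀ᶠ p in 𝓝 0, H (hornMap p) = gaussProduct q p) ∧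
      IsDoubleSeries H (hornH5Coefficient q (q - 1 / 2) (2 * q)) := by
  have hc : ∀ k : ℕ, q + 1 / 2 ≠ -(k : ℂ) := fun k hk =>
    hq (2 * k + 1) (by push_cast; linear_combination 2 * hk)
  have hc' : ∀ k : ℕ, 3 / 2 - q ≠ -(k : ℂ) := fun k hk => hb k (by linear_combination -hk)
  obtain ⟨ψ, hψ, hψ0, hl, hr⟩ := exists_hornMap_inverse
  have hH : AnalyticAt ℂ (gaussProduct q ∘ ψ) 0 :=
    (analyticAt_gaussProduct hc hc').comp_of_eq hψ hψ0
  set H := gaussProduct q ∘ ψ with hHdef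
  have hHp : ∀ᶠ p in 𝓝 0, H (hornMap p) = gaussProduct q p := by
    filter_upwards [hl] with p hp
    simp [hHdef, hp]
  obtain ⟨d, hd⟩ := hH.exists_isDoubleSeries
  refine ⟨H, hHp, ?_⟩
  have hψt : Tendsto ψ (𝓝 0) (𝓝 0) := by
    simpa only [hψ0] using hψ.continuousAt.tendsto
  obtain ⟨F₁, G₁, hB⟩ := exists_eulerBasis hc hc'
  -- Evaluation at ψ(s) turns the equation along the image of the substitution into one valid at
  -- every s near 0.
  have heq := (hψt.eventually (horn_equation hB hH hHp)).and hr
  have hrec := horn_recursion hd (a := q) (b := q - 1 / 2) (c := 2 * q) <| by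
    filter_upwards [heq] with s hs
    have h2 : (hornX (ψ s), hornY (ψ s)) = s := hs.2
    have h3 : hornY (ψ s) = s.2 := congrArg Prod.snd h2
    have h1 := hs.1
    simp only [h2] at h1
    rwa [h3] at h1
  suffices h0 : ∀ m, d (m, 0) = ordinaryHypergeometricCoefficient (1 / 2 * q) (1 / 2 * q + 1 / 2)
      (3 / 2 - q) m * (-4) ^ m by
    rwa [← coefficients_eq_hornH5 hq hb h0 hrec]
  have tl : Tendsto (fun X : ℂ => ((X, 0) : ℂ × ℂ)) (𝓝 0) (𝓝 0) := by
    have : Continuous (fun X : ℂ => ((X, 0) : ℂ × ℂ)) := by fun_prop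
    exact this.tendsto 0
  have t4 : Tendsto (fun X : ℂ => ((4 * X, 0) : ℂ × ℂ)) (𝓝 0) (𝓝 0) := by
    have : Continuous (fun X : ℂ => ((4 * X, 0) : ℂ × ℂ)) := by fun_prop
    simpa using! this.tendsto 0
  have tn : Tendsto (fun X : ℂ => -4 * X) (𝓝 0) (𝓝 0) := by
    have : Continuous (fun X : ℂ => -4 * X) := by fun_prop
    simpa using this.tendsto 0
  -- On the axis Y = 0, the series of H and that of the second Gauss function at -4X represent the
  -- same function of X.
  have hz := coeff_eq_zero_of_hasSum_zero (a := fun m => d (m, 0) -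
    ordinaryHypergeometricCoefficient (1 / 2 * q) (1 / 2 * q + 1 / 2) (3 / 2 - q) m * (-4) ^ m) <| by
    filter_upwards [tl.eventually hd.2, t4.eventually hHp,
      tn.eventually (eventually_hasSum_hypergeometric (a := 1 / 2 * q) (b := 1 / 2 * q + 1 / 2) hc')]
      with X h1 h2 h3
    have e : H (X, 0) =
        ordinaryHypergeometric (1 / 2 * q) (1 / 2 * q + 1 / 2) (3 / 2 - q) (-4 * X) := by
      rw [hornMap_four_mul] at h2
      rw [h2, gaussProduct]
      simp
    have hinj : Function.Injective (fun m : ℕ => (m, 0)) := fun m n h => by simpa using h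
    rw [← hinj.hasSum_iff (by
      rintro ⟨m, n⟩ hk
      have : n ≠ 0 := fun hn => hk ⟨m, by simp [hn]⟩
      simp [this]), e] at h1
    have := h1.sub h3
    rw [sub_self] at this
    convert! this using 2 with m
    simp only [Function.comp, pow_zero, mul_one, mul_pow]
    ring
  intro m
  exact sub_eq_zero.1 (congrFun hz m)

end

theorem mainTheorem3 (q : ℂ)
    (hc : ∀ k : ℕ, 2 * q ≠ -(k : ℂ))
    (hb : ∀ k : ℕ, q - 1 / 2 ≠ (k : ℂ) + 1) :
    ∀ᶠ p : ℂ × ℂ in 𝓝 ((0 : ℂ), (0 : ℂ)), ∀ x y : ℂ, p = (x, y) →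
      Summable (hornH5Term q (q - 1 / 2) (2 * q)
        (x * (y - 1) ^ 2 / (4 * (3 * x * y - 1) ^ 2))
        (4 * (x * y ^ 2 + 1) * (x + 1) * y / ((3 * x * y - 1) * (y - 1) ^ 2))) ∧
      hornH5 q (q - 1 / 2) (2 * q)
        (x * (y - 1) ^ 2 / (4 * (3 * x * y - 1) ^ 2))
        (4 * (x * y ^ 2 + 1) * (x + 1) * y / ((3 * x * y - 1) * (y - 1) ^ 2)) =
      (1 - 3 * x * y) ^ q * (1 - y) ^ (2 * q - 1) *
        ordinaryHypergeometric (3 / 2 * q - 1 / 2) (3 / 2 * q) (q + 1 / 2) (-(x * y ^ 2)) *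
        ordinaryHypergeometric (1 / 2 * q) (1 / 2 * q + 1 / 2) (3 / 2 - q) (-x) := by
  obtain ⟨H, hHp, hH⟩ := isDoubleSeries_of_comp_hornMap hc hb
  have hm : Tendsto hornMap (𝓝 0) (𝓝 0) := tendsto_horn
  rw [Prod.mk_zero_zero]
  filter_upwards [hHp, hm.eventually hH.2] with p hp hs x y hxy
  subst hxy
  -- By definition the term of H₅ is its coefficient times the monomial, so the expansion of H is
  -- literally the H₅ series.
  have hsum : HasSum (hornH5Term q (q - 1 / 2) (2 * q)
      (x * (y - 1) ^ 2 / (4 * (3 * x * y - 1) ^ 2))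
      (4 * (x * y ^ 2 + 1) * (x + 1) * y / ((3 * x * y - 1) * (y - 1) ^ 2))) (H (hornMap (x, y))) :=
    hs
  refine ⟨hsum.summable, hsum.tsum_eq.trans ?_⟩
  rw [hp, gaussProduct]
  ring
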